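/- **Conventions.** For $c>0$ let $\mathcal F_c[f](x)=\int_{-1}^{1}e^{icxy}f(y)\,dy$ on $L^2([-1,1])$. A sequence of prolate spheroidal wave functions (PSWFs) of bandwidth $c$ with eigenvalues $(\mu_j)_{j\ge 0}$ is a sequence $(\psi_j)_{j\ge0}$ of real-valued, orthonormal functions in $L^2([-1,1])$ with $\mathcal F_c[\psi_j]=\mu_j\psi_j$ pointwise on $[-1,1]$, listed so that $|\mu_{j+1}|\le|\mu_j|$, and such that no non-zero (complex-valued) eigenfunction of $\mathcal F_c$ in $L^2([-1,1])$ is orthogonal to all $\psi_j$. For $g$ in the range of $\mathcal F_c$ put $$\mathcal F_c^{-1}[g]=\sum_{j\ge0}\frac1{\mu_j}\,\psi_j\int_{-1}^{1}\psi_j(x)g(x)\,dx\qquad(\text{convergence in }L^2([-1,1])).$$ For $d\ge1$ let $B_\rho=\{q\in\mathbb R^d:|q|<\rho\}$, $\hat v(p)=(2\pi)^{-d}\int_{\mathbb R^d}e^{ip\cdot q}v(q)\,dq$, and define the inverse Radon transform of a function $u$ on $\mathbb R\times\mathbb S^{d-1}$ by $$\mathcal R^{-1}[u](q)=\frac1{(2\pi)^{d-1}}\int_{\mathbb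 S^{d-1}}\int_0^{\infty}e^{-is\theta\cdot q}\,\hat u(s,\theta)\,s^{d-1}\,ds\,d\theta,\qquad \hat u(s,\theta)=\frac1{2\pi}\int_{\mathbb R}e^{ist}u(t,\theta)\,dt,$$ where $d\theta$ is surface measure (counting measure on $\{\pm1\}$ if $d=1$) and $\int_0^\infty$ means the limit in $L^2(\mathbb R^d)$, as $R\to\infty$, of the integrals over $0<s\le R$. **Theorem 1.1.** Let $d\ge1$, $r,\sigma>0$ and $c=r\sigma$. Let $v\in L^2(\mathbb R^d)$ be complex-valued and vanish almost everywhere outside $B_\sigma$. Then PSWFs of bandwidth $c$ exist and, for any choice of them, all $\mu_j$ are non-zero and $v$ is obtained from the restriction of $\hat v$ to $B_r$ as follows. For every $\theta\in\mathbb S^{d-1}$, let $$g_{r,\theta}(x)=\Big(\frac{2\pi}{\sigma}\Big)^{d}\hat v(rx\theta),\qquad x\in(-1,1).$$ The series for $\mathcal F_c^{-1}[g_{r,\theta}]$ converges in $L^2([-1,1])$. With $$f_{r,\sigma}(y,\theta)=\begin{cases}\mathcal F_c^{-1}[g_{r,\theta}](y),& y\in[-1,1],\\ 0,&\text{otherwise,}\end{cases}$$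 the inverse Radon transform $\mathcal R^{-1}[f_{r,\sigma}]$ exists in $L^2(\mathbb R^d)$ and $$v(q)=\mathcal R^{-1}[f_{r,\sigma}](\sigma^{-1}q)\qquad\text{for almost every } q\in\mathbb R^d.$$ In particular, if $v'\in L^2(\mathbb R^d)$ also vanishes almost everywhere outside $B_\sigma$ and $\hat v'=\hat v$ on $B_r$, then $v'=v$ almost everywhere. -/

import Mathlib

open MeasureTheory Filter Topology

namespace PSWF

noncomputable section

/-- Lebesgue measure on the interval `[-1, 1]`. -/
def intervalMeasure : Measure ℝ := volume.restrict (Set.Icc (-1) 1)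

/-- The band-limited Fourier operator `f ↦ ∫_{-1}^{1} e^{icxy} f(y) dy`. -/
def bandOp (c : ℝ) (f : ℝ → ℂ) (x : ℝ) : ℂ :=
  ∫ y in Set.Icc (-1 : ℝ) 1, Complex.exp (Complex.I * ((c * x * y : ℝ) : ℂ)) * f y

/-- `(ψ j)` is a sequence of prolate spheroidal wave functions of bandwidth `c`, with
eigenvalues `(μ j)`: real-valued orthonormal eigenfunctions of `bandOp c` in `L²([-1, 1])`,
listed with `|μ j|` non-increasing, which exhaust the eigenfunctions, i.e. no non-zero
(complex-valued) eigenfunction is orthogonal to all of them.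
Neither completeness in `L²([-1, 1])` nor `μ j ≠ 0` is part of the definition. -/
structure IsPSWF (c : ℝ) (ψ : ℕ → ℝ → ℝ) (μ : ℕ → ℂ) : Prop where
  memLp : ∀ j, MemLp (ψ j) 2 intervalMeasure
  orthonormal : ∀ i j, ∫ y in Set.Icc (-1 : ℝ) 1, ψ i y * ψ j y = if i = j then 1 else 0
  eigen : ∀ j, ∀ x ∈ Set.Icc (-1 : ℝ) 1, bandOp c (fun y => (ψ j y : ℂ)) x = μ j * (ψ j x : ℂ)
  antitone : Antitone fun j => ‖μ j‖
  exhaustive : ∀ (h : ℝ → ℂ) (lam : ℂ), MemLp h 2 intervalMeasure →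
    (∀ x ∈ Set.Icc (-1 : ℝ) 1, bandOp c h x = lam * h x) →
    (∀ j, ∫ y in Set.Icc (-1 : ℝ) 1, (ψ j y : ℂ) * h y = 0) →
    h =ᵐ[intervalMeasure] 0

/-- Partial sum `∑_{j < n} μ_j⁻¹ ψ_j(y) ∫_{-1}^{1} ψ_j(x) g(x) dx`. -/
def inversePartialSum (ψ : ℕ → ℝ → ℝ) (μ : ℕ → ℂ) (g : ℝ → ℂ) (n : ℕ) (y : ℝ) : ℂ :=
  ∑ j ∈ Finset.range n,
    1 / μ j * (ψ j y : ℂ) * ∫ x in Set.Icc (-1 : ℝ) 1, (ψ j x : ℂ) * g x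

/-- `f` is the sum in `L²([-1, 1])` of the series
`∑_j μ_j⁻¹ ψ_j(y) ∫_{-1}^{1} ψ_j(x) g(x) dx`, that is, `f = F_c⁻¹[g]`. -/
def IsBandInverse (ψ : ℕ → ℝ → ℝ) (μ : ℕ → ℂ) (g f : ℝ → ℂ) : Prop :=
  MemLp f 2 intervalMeasure ∧
    Tendsto (fun n => eLpNorm (fun y => inversePartialSum ψ μ g n y - f y) 2 intervalMeasure)
      atTop (𝓝 0)

/-- `ℝ^d` with its Euclidean norm. -/
abbrev Space (d : ℕ) : Type := EuclideanSpace ℝ (Fin d)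

/-- The unit sphere `S^{d-1}` of `ℝ^d`; it carries the surface measure
`(volume : Measure (Space d)).toSphere` (counting measure if `d = 1`). -/
abbrev Sphere (d : ℕ) : Type := Metric.sphere (0 : Space d) 1

/-- `v̂(p) = (2π)^{-d} ∫_{ℝ^d} e^{ip·q} v(q) dq`. -/
def fourierHat {d : ℕ} (v : Space d → ℂ) (p : Space d) : ℂ :=
  1 / ((2 * Real.pi : ℝ) : ℂ) ^ d *
    ∫ q : Space d, Complex.exp (Complex.I * ((inner ℝ p q : ℝ) : ℂ)) * v q

/-- `û(s, θ) = (2π)^{-1} ∫_ℝ e^{ist} u(t, θ) dt`. -/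
def lineHat {d : ℕ} (u : ℝ → Sphere d → ℂ) (s : ℝ) (θ : Sphere d) : ℂ :=
  1 / ((2 * Real.pi : ℝ) : ℂ) * ∫ t : ℝ, Complex.exp (Complex.I * ((s * t : ℝ) : ℂ)) * u t θ

/-- `(2π)^{-(d-1)} ∫_{S^{d-1}} ∫_0^R e^{-is θ·q} û(s, θ) s^{d-1} ds dθ`. -/
def radonInvTrunc {d : ℕ} (u : ℝ → Sphere d → ℂ) (R : ℝ) (q : Space d) : ℂ :=
  1 / ((2 * Real.pi : ℝ) : ℂ) ^ (d - 1) *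
    ∫ θ : Sphere d, (∫ s in Set.Ioc (0 : ℝ) R,
      Complex.exp (-Complex.I * ((s * inner ℝ (θ : Space d) q : ℝ) : ℂ)) *
        lineHat u s θ * ((s ^ (d - 1) : ℝ) : ℂ)) ∂(volume : Measure (Space d)).toSphere

/-- `w` is the inverse Radon transform
`(2π)^{-(d-1)} ∫_{S^{d-1}} ∫_0^∞ e^{-is θ·q} û(s, θ) s^{d-1} ds dθ` of `u`, the improper integral
in `s` being taken, as usual for Fourier inversion of `L²` functions, as a limit in `L²(ℝ^d)`. -/
def IsRadonInverse {d : ℕ} (u : ℝ → Sphere d → ℂ) (w : Space d → ℂ) : Prop :=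
  MemLp w 2 volume ∧ (∀ R, MemLp (radonInvTrunc u R) 2 volume) ∧
    Tendsto (fun R => eLpNorm (radonInvTrunc u R - w) 2 volume) atTop (𝓝 0)

/-- The inverse Radon transform is unique as an element of `L²(ℝ^d)`. -/
theorem IsRadonInverse.ae_eq {d : ℕ} {u : ℝ → Sphere d → ℂ} {w w' : Space d → ℂ}
    (h : IsRadonInverse u w) (h' : IsRadonInverse u w') : w =ᵐ[volume] w' := by
  have hle : ∀ R, eLpNorm (w - w') 2 volume ≤
      eLpNorm (radonInvTrunc u R - w) 2 volume + eLpNorm (radonInvTrunc u R - w') 2 volume := by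
    intro R
    have e : w - w' = (w - radonInvTrunc u R) + (radonInvTrunc u R - w') := by abel
    rw [e, eLpNorm_sub_comm (radonInvTrunc u R) w]
    exact eLpNorm_add_le (h.1.sub (h.2.1 R)).1 ((h.2.1 R).sub h'.1).1 (by norm_num)
  have ht := h.2.2.add h'.2.2
  rw [add_zero] at ht
  have h0 : eLpNorm (w - w') 2 volume = 0 :=
    le_antisymm (ge_of_tendsto' ht hle) (zero_le)
  rw [eLpNorm_eq_zero_iff (h.1.sub h'.1).1 (by norm_num)] at h0
  filter_upwards [h0] with q hq
  exact sub_eq_zero.mp hq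

/-- The rescaled data on the line through the origin with direction `θ`:
`g_{r,θ}(x) = (2π/σ)^d V(r x θ)`, where `V` is the given Fourier transform. -/
def lineData {d : ℕ} (r σ : ℝ) (V : Space d → ℂ) (θ : Sphere d) (x : ℝ) : ℂ :=
  (((2 * Real.pi / σ) ^ d : ℝ) : ℂ) * V ((r * x) • (θ : Space d))

/-- Extension by zero of `y ↦ h θ y`, `y ∈ [-1, 1]`, to all `y ∈ ℝ`. -/
def extendByZero {d : ℕ} (h : Sphere d → ℝ → ℂ) (y : ℝ) (θ : Sphere d) : ℂ :=
  Set.indicator (Set.Icc (-1) 1) (h θ) y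

end

end PSWF

/-!
The proof has two independent halves, joined by the projection-slice identity.

*Spectral half.* On real `L²([-1, 1])` the operator `F_c` splits as `C + iS`, where `C` and `S` have
the kernels `cos (cxy)` and `sin (cxy)`. Expanding these in Taylor series gives
`C = ∑ aₙ ⟨xⁿ, ·⟩ xⁿ` with only even `n` and `S = ∑ bₙ ⟨xⁿ, ·⟩ xⁿ` with only odd `n`. From this form
one reads off that both operators are compact and symmetric, that `CS = SC = 0` because even and odd
monomials are orthogonal, and that `C` and `S` have no common kernel: `Cu = Su = 0` forces all
moments of `u` to vanish, hence `u = 0` by Weierstrass (`isSplitPair_taylorOp`). Real eigenfunctions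
of `F_c` are the joint eigenvectors of `C` and `S`, and `exists_joint_eigenvector` finds one in the
orthogonal complement of any invariant subspace, with an eigenvalue of largest possible modulus.
Choosing greedily gives a sequence of prolate spheroidal wave functions (`exists_isPSWF`); applied
to the span of an arbitrary such sequence, the same lemma shows that it is complete
(`IsPSWF.total`). No eigenvalue is zero since `F_c` is injective. Because `F_c` is symmetric for the
bilinear pairing, the series for `F_c⁻¹[F_c f]` is the expansion of `f` in the orthonormal basis
`(ψ_j)`, and it converges to `f` (`IsPSWF.isBandInverse`).

*Fourier half.* Let `v_σ(q) = v(σq)`, supported in the unit ball. In each direction `θ` it has a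
slice `f_θ ∈ L²([-1, 1])`, its Radon transform, with
`∫ e^{isy} f_θ(y) dy = ∫ e^{isθ·q} v_σ(q) dq` for all `s` (`exists_slice`). Hence the data `g_{r,θ}` equal `F_c f_θ`, and `F_c⁻¹[g_{r,θ}] = f_θ`. In polar
coordinates the truncated inverse Radon transform of these slices is the inverse Fourier integral of
the Fourier transform of `v_σ` over a ball (`radonInvTrunc_eq_fourier`), which converges to `v_σ` in
`L²` by Plancherel's theorem (`tendsto_fourier_indicator_fourierInv`).

Uniqueness follows, since two functions with the same data are reconstructed from the same slices.
-/

namespace PSWF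

/-! ### Commuting compact symmetric operators on a real Hilbert space -/

section Spectral

variable {E : Type*} [NormedAddCommGroup E] [InnerProductSpace ℝ E]

/-- A nonzero compact symmetric operator has an eigenvalue of modulus equal to its norm. -/
theorem exists_unit_eigenvector [CompleteSpace E] {T : E →L[ℝ] E} (hc : IsCompactOperator T)
    (hs : T.IsSymmetric) (hT : T ≠ 0) :
    ∃ u : E, ‖u‖ = 1 ∧ ∃ l : ℝ, |l| = ‖T‖ ∧ T u = l • u := by
  have hT0 : 0 < ‖T‖ := norm_pos_iff.mpr hT
  have : Nontrivial E := by
    by_contra h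
    rw [not_nontrivial_iff_subsingleton] at h
    exact hT (Subsingleton.elim _ _)
  have key : ∃ l : ℝ, |l| = ‖T‖ ∧ l ∈ spectrum ℝ T := by
    by_contra! h
    have h1 := h ‖T‖ (abs_of_pos hT0)
    have h2 := h (-‖T‖) (by rw [abs_neg, abs_of_pos hT0])
    simp only [spectrum, Set.mem_compl_iff, not_not] at h1 h2
    obtain ⟨c, hc0, hc⟩ := T.abs_rayleighQuotient_le_of_norm_mem_resolventSet
      (by simpa using h1) (by simpa using h2)
    have h3 := T.norm_eq_iSup_rayleighQuotient hs
    have h4 := ciSup_le hc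
    linarith
  obtain ⟨l, hl, hsp⟩ := key
  have hl0 : l ≠ 0 := by
    rintro rfl
    simp at hl
    exact hT0.ne hl
  obtain ⟨v, hv⟩ := ((hc.hasEigenvalue_iff_mem_spectrum hl0).mpr hsp).exists_hasEigenvector
  have hv0 : ‖v‖ ≠ 0 := norm_ne_zero_iff.mpr hv.2
  have hv1 : T v = l • v := hv.apply_eq_smul
  refine ⟨‖v‖⁻¹ • v, by rw [norm_smul, norm_inv, norm_norm, inv_mul_cancel₀ hv0], l, hl, ?_⟩
  rw [map_smul, hv1, smul_comm]

/-- A pair of compact symmetric operators with zero products and no common kernel. The cosine and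
sine parts of the band-limited Fourier operator form such a pair, with products zero because one
takes values in the even and the other in the odd functions. -/
structure IsSplitPair (C S : E →L[ℝ] E) : Prop where
  compact_left : IsCompactOperator C
  compact_right : IsCompactOperator S
  symm_left : C.IsSymmetric
  symm_right : S.IsSymmetric
  left_right : ∀ u, C (S u) = 0
  right_left : ∀ u, S (C u) = 0
  injective : ∀ u, C u = 0 → S u = 0 → u = 0

theorem IsSplitPair.swap {C S : E →L[ℝ] E} (h : IsSplitPair C S) : IsSplitPair S C :=
  ⟨h.2, h.1, h.4, h.3, h.6, h.5, fun u h1 h2 => h.7 u h2 h1⟩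

theorem orthogonal_invariant {T : E →L[ℝ] E} (hs : T.IsSymmetric) {V : Submodule ℝ E}
    (hV : ∀ u ∈ V, T u ∈ V) : ∀ u ∈ Vᗮ, T u ∈ Vᗮ := by
  intro u hu w hw
  exact (hs w u).symm.trans (hu _ (hV w hw))

/-- The case of `exists_joint_eigenvector` in which the first operator has the larger norm on the
orthogonal complement. -/
theorem exists_joint_eigenvector_aux [CompleteSpace E] {C S : E →L[ℝ] E} (h : IsSplitPair C S)
    {V : Submodule ℝ E} (hC : ∀ u ∈ Vᗮ, C u ∈ Vᗮ) (hS : ∀ u ∈ Vᗮ, S u ∈ Vᗮ) (hV : Vᗮ ≠ ⊥)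
    (hle : ‖S.restrict hS‖ ≤ ‖C.restrict hC‖) :
    ∃ u ∈ Vᗮ, ‖u‖ = 1 ∧ ∃ l : ℝ, C u = l • u ∧ S u = 0 ∧
      ∀ w ∈ Vᗮ, ‖C w‖ ≤ |l| * ‖w‖ ∧ ‖S w‖ ≤ |l| * ‖w‖ := by
  have hne : C.restrict hC ≠ 0 := by
    intro h0
    rw [h0, ContinuousLinearMap.opNorm_zero] at hle
    apply hV
    rw [Submodule.eq_bot_iff]
    intro u hu
    refine h.injective u ?_ ?_
    · simpa using congrArg Subtype.val (congrArg (fun T => T ⟨u, hu⟩) h0)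
    · refine norm_le_zero_iff.mp (((S.restrict hS).le_opNorm ⟨u, hu⟩).trans ?_)
      exact mul_nonpos_of_nonpos_of_nonneg hle (norm_nonneg _)
  obtain ⟨u, hu1, l, hl, hul⟩ := exists_unit_eigenvector
    (T := C.restrict hC) (h.compact_left.restrict' hC)
    (h.symm_left.restrict_invariant hC) hne
  have hCu : C u = l • (u : E) := congrArg Subtype.val hul
  have hl0 : l ≠ 0 := by
    rintro rfl
    rw [abs_zero] at hl
    exact hne (norm_eq_zero.mp hl.symm)
  refine ⟨u, u.2, hu1, l, hCu, ?_, fun w hw => ⟨?_, ?_⟩⟩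
  · have := h.right_left u
    rw [hCu, map_smul] at this
    exact (smul_eq_zero.mp this).resolve_left hl0
  · rw [hl]
    exact (C.restrict hC).le_opNorm ⟨w, hw⟩
  · rw [hl]
    exact ((S.restrict hS).le_opNorm ⟨w, hw⟩).trans
      (mul_le_mul_of_nonneg_right hle (norm_nonneg _))

/-- On the orthogonal complement of an invariant subspace, a split pair has a joint eigenvector,
and it can be chosen with the eigenvalue of `C + iS` as large as possible in modulus. -/
theorem exists_joint_eigenvector [CompleteSpace E] {C S : E →L[ℝ] E} (h : IsSplitPair C S)
    {V : Submodule ℝ E} (hC : ∀ u ∈ V, C u ∈ V) (hS : ∀ u ∈ V, S u ∈ V) (hV : Vᗮ ≠ ⊥) :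
    ∃ u ∈ Vᗮ, ‖u‖ = 1 ∧ ∃ l : ℂ, C u = l.re • u ∧ S u = l.im • u ∧
      ∀ w ∈ Vᗮ, ‖C w‖ ≤ ‖l‖ * ‖w‖ ∧ ‖S w‖ ≤ ‖l‖ * ‖w‖ := by
  have hC' := orthogonal_invariant h.symm_left hC
  have hS' := orthogonal_invariant h.symm_right hS
  rcases le_total ‖S.restrict hS'‖ ‖C.restrict hC'‖ with hle | hle
  · obtain ⟨u, hu, hu1, l, h1, h2, h3⟩ := exists_joint_eigenvector_aux h hC' hS' hV hle
    exact ⟨u, hu, hu1, l, by simpa using h1, by simpa using h2, by simpa using h3⟩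
  · obtain ⟨u, hu, hu1, l, h1, h2, h3⟩ := exists_joint_eigenvector_aux h.swap hS' hC' hV hle
    refine ⟨u, hu, hu1, l * Complex.I, by simpa using h2, by simpa using h1, fun w hw => ?_⟩
    simpa using (h3 w hw).symm

/-- The eigenvalues of a compact operator along an orthonormal sequence of eigenvectors are not
bounded away from zero. -/
theorem exists_eigenvalue_lt {T : E →L[ℝ] E} (hc : IsCompactOperator T) {f : ℕ → E}
    (hf : Orthonormal ℝ f) {l : ℕ → ℝ} (hl : ∀ n, T (f n) = l n • f n) {ε : ℝ} (hε : 0 < ε) :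
    ∃ n, |l n| < ε := by
  by_contra! hge
  obtain ⟨K, hK, hTK⟩ :=
    IsCompactOperator.image_closedBall_subset_compact (f := (T : E →ₗ[ℝ] E)) hc 1
  have hmem : ∀ n, T (f n) ∈ K := fun n =>
    hTK ⟨f n, by simp [hf.1 n], rfl⟩
  obtain ⟨a, -, φ, hφ, hlim⟩ := hK.tendsto_subseq hmem
  obtain ⟨N, hN⟩ := Metric.cauchySeq_iff.mp hlim.cauchySeq ε hε
  have h1 := hN N le_rfl (N + 1) (Nat.le_succ N)
  have hne : φ N ≠ φ (N + 1) := hφ.injective.ne (Nat.succ_ne_self N).symm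
  -- pairing with the first of the two eigenvectors bounds the distance below by its eigenvalue
  have h2 : inner ℝ (f (φ N)) (T (f (φ N)) - T (f (φ (N + 1)))) = l (φ N) := by
    rw [hl, hl, inner_sub_right, inner_smul_right, inner_smul_right, hf.2 hne,
      real_inner_self_eq_norm_sq, hf.1]
    ring
  have h3 := abs_real_inner_le_norm (f (φ N)) (T (f (φ N)) - T (f (φ (N + 1))))
  rw [h2, hf.1, one_mul] at h3
  simp only [Function.comp_apply, dist_eq_norm] at h1
  linarith [hge (φ N)]

/-- A split pair on an infinite-dimensional Hilbert space has an orthonormal sequence of joint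
eigenvectors, with `C + iS` having eigenvalues of non-increasing modulus, that is total. It is
built greedily, each vector having the largest possible eigenvalue on the orthogonal complement of
its predecessors. -/
theorem exists_orthonormal_joint_eigenvectors [CompleteSpace E] (hE : ¬ FiniteDimensional ℝ E)
    {C S : E →L[ℝ] E} (h : IsSplitPair C S) :
    ∃ (f : ℕ → E) (l : ℕ → ℂ), Orthonormal ℝ f ∧
      (∀ n, C (f n) = (l n).re • f n ∧ S (f n) = (l n).im • f n) ∧
      (Antitone fun n => ‖l n‖) ∧ ∀ u, (∀ n, inner ℝ (f n) u = 0) → u = 0 := by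
  let P : Submodule ℝ E → Prop := fun V =>
    FiniteDimensional ℝ V ∧ (∀ u ∈ V, C u ∈ V) ∧ (∀ u ∈ V, S u ∈ V)
  have hstep : ∀ V : Submodule ℝ E, ∃ p : E × ℂ, P V → p.1 ∈ Vᗮ ∧ ‖p.1‖ = 1 ∧
      C p.1 = p.2.re • p.1 ∧ S p.1 = p.2.im • p.1 ∧
      ∀ w ∈ Vᗮ, ‖C w‖ ≤ ‖p.2‖ * ‖w‖ ∧ ‖S w‖ ≤ ‖p.2‖ * ‖w‖ := by
    intro V
    by_cases hP : P V
    · have hV : Vᗮ ≠ ⊥ := by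
        intro h0
        have h2 := hP.1
        rw [Submodule.orthogonal_eq_bot_iff] at h0
        apply hE
        rw [h0] at h2
        exact Module.finite_def.mpr ((Submodule.fg_top _).mp (Module.finite_def.mp h2))
      obtain ⟨u, hu, hu1, l, h1, h2, h3⟩ := exists_joint_eigenvector h hP.2.1 hP.2.2 hV
      exact ⟨(u, l), fun _ => ⟨hu, hu1, h1, h2, h3⟩⟩
    · exact ⟨(0, 0), fun hP' => absurd hP' hP⟩
  choose g hg using hstep
  obtain ⟨V, hV0, hVs⟩ : ∃ V : ℕ → Submodule ℝ E, V 0 = ⊥ ∧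
      ∀ n, V (n + 1) = V n ⊔ Submodule.span ℝ {(g (V n)).1} :=
    ⟨fun n => Nat.rec ⊥ (fun _ W => W ⊔ Submodule.span ℝ {(g W).1}) n, rfl, fun _ => rfl⟩
  have hP : ∀ n, P (V n) := by
    intro n
    induction n with
    | zero =>
      rw [hV0]
      exact ⟨inferInstance, fun u hu => by simp_all, fun u hu => by simp_all⟩
    | succ n ih =>
      have aux : ∀ (T : E →L[ℝ] E) (a : ℝ), (∀ u ∈ V n, T u ∈ V n) →
          T (g (V n)).1 = a • (g (V n)).1 → ∀ u ∈ V (n + 1), T u ∈ V (n + 1) := by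
        intro T a hT hTa u hu
        rw [hVs] at hu ⊢
        obtain ⟨x, hx, y, hy, rfl⟩ := Submodule.mem_sup.mp hu
        obtain ⟨b, rfl⟩ := Submodule.mem_span_singleton.mp hy
        rw [map_add, map_smul, hTa]
        exact Submodule.add_mem_sup (hT x hx) (Submodule.smul_mem _ _
          (Submodule.smul_mem _ _ (Submodule.mem_span_singleton_self _)))
      refine ⟨?_, aux C _ ih.2.1 (hg _ ih).2.2.1, aux S _ ih.2.2 (hg _ ih).2.2.2.1⟩
      have : FiniteDimensional ℝ (V n) := ih.1
      rw [hVs]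
      exact Submodule.finiteDimensional_sup _ _
  have hmono : Monotone V := monotone_nat_of_le_succ fun n => by rw [hVs]; exact le_sup_left
  have hmem : ∀ m n, m < n → (g (V m)).1 ∈ V n := fun m n hmn =>
    hmono (Nat.succ_le_of_lt hmn) (by
      rw [hVs]
      exact Submodule.mem_sup_right (Submodule.mem_span_singleton_self _))
  have hperp : ∀ m n, m ≤ n → (g (V n)).1 ∈ (V m)ᗮ := fun m n hmn =>
    Submodule.orthogonal_le (hmono hmn) (hg _ (hP n)).1
  let f : ℕ → E := fun n => (g (V n)).1
  let l : ℕ → ℂ := fun n => (g (V n)).2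
  have hf1 : ∀ n, ‖f n‖ = 1 := fun n => (hg _ (hP n)).2.1
  have hCf : ∀ n, C (f n) = (l n).re • f n := fun n => (hg _ (hP n)).2.2.1
  have hSf : ∀ n, S (f n) = (l n).im • f n := fun n => (hg _ (hP n)).2.2.2.1
  have hbd : ∀ n, ∀ w ∈ (V n)ᗮ, ‖C w‖ ≤ ‖l n‖ * ‖w‖ ∧ ‖S w‖ ≤ ‖l n‖ * ‖w‖ :=
    fun n => (hg _ (hP n)).2.2.2.2
  have hon : Orthonormal ℝ f := by
    refine ⟨hf1, fun m n hmn => ?_⟩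
    rcases lt_or_gt_of_ne hmn with hlt | hlt
    · exact hperp n n le_rfl _ (hmem m n hlt)
    · rw [real_inner_comm]
      exact hperp m m le_rfl _ (hmem n m hlt)
  -- since the products vanish, every eigenvalue of `C + iS` is real or purely imaginary
  have hprod : ∀ n, (l n).re * (l n).im = 0 := by
    intro n
    have h1 := h.left_right (f n)
    rw [hSf, map_smul, hCf, smul_smul] at h1
    have h2 := (smul_eq_zero.mp h1).resolve_right (fun h0 => by simpa [h0] using hf1 n)
    linarith
  have hnorm : ∀ n, ‖l n‖ = |(l n).re + (l n).im| := by
    intro n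
    rcases mul_eq_zero.mp (hprod n) with h0 | h0
    · rw [h0, zero_add, Complex.norm_def, Complex.normSq_apply, h0, zero_mul, zero_add,
        ← sq, Real.sqrt_sq_eq_abs]
    · rw [h0, add_zero, Complex.norm_def, Complex.normSq_apply, h0, zero_mul, add_zero,
        ← sq, Real.sqrt_sq_eq_abs]
  refine ⟨f, l, hon, fun n => ⟨hCf n, hSf n⟩, ?_, ?_⟩
  · refine antitone_nat_of_succ_le fun n => ?_
    have hb := hbd n (f (n + 1)) (hperp n (n + 1) (Nat.le_succ n))
    rw [hCf (n + 1), hSf (n + 1), norm_smul, norm_smul, hf1 (n + 1), mul_one, mul_one,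
      mul_one] at hb
    rw [hnorm (n + 1)]
    rcases mul_eq_zero.mp (hprod (n + 1)) with h0 | h0
    · rw [h0, zero_add]
      exact hb.2
    · rw [h0, add_zero]
      exact hb.1
  · intro u hu
    have huV : ∀ n, u ∈ (V n)ᗮ := by
      intro n
      induction n with
      | zero => simp [hV0]
      | succ n ih =>
        rw [hVs, ← Submodule.inf_orthogonal]
        refine ⟨ih, ?_⟩
        rw [SetLike.mem_coe, Submodule.mem_orthogonal_singleton_iff_inner_right]
        exact hu n
    have hsmall : ∀ ε > 0, ‖C u‖ ≤ ε * ‖u‖ ∧ ‖S u‖ ≤ ε * ‖u‖ := by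
      intro ε hε
      have hadd : ∀ n, (C + S) (f n) = ((l n).re + (l n).im) • f n := fun n => by
        rw [add_apply, hCf, hSf, add_smul]
      obtain ⟨n, hn⟩ := exists_eigenvalue_lt (h.compact_left.add h.compact_right) hon hadd hε
      rw [← hnorm n] at hn
      have hb := hbd n u (huV n)
      exact ⟨hb.1.trans (by gcongr), hb.2.trans (by gcongr)⟩
    have hlim : Tendsto (fun ε : ℝ => ε * ‖u‖) (𝓝[>] 0) (𝓝 0) := by
      have : Tendsto (fun ε : ℝ => ε * ‖u‖) (𝓝 0) (𝓝 (0 * ‖u‖)) :=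
        (continuous_id.mul continuous_const).tendsto 0
      rw [zero_mul] at this
      exact this.mono_left nhdsWithin_le_nhds
    have hC0 : ‖C u‖ ≤ 0 := ge_of_tendsto hlim
      (eventually_nhdsWithin_of_forall fun ε hε => (hsmall ε hε).1)
    have hS0 : ‖S u‖ ≤ 0 := ge_of_tendsto hlim
      (eventually_nhdsWithin_of_forall fun ε hε => (hsmall ε hε).2)
    exact h.injective u (norm_le_zero_iff.mp hC0) (norm_le_zero_iff.mp hS0)

end Spectral

/-! ### Taylor expansion of the band-limited Fourier operator -/

instance : IsFiniteMeasure intervalMeasure := by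
  unfold intervalMeasure; infer_instance

theorem ae_intervalMeasure_mem : ∀ᵐ x ∂intervalMeasure, x ∈ Set.Icc (-1 : ℝ) 1 :=
  ae_restrict_mem measurableSet_Icc

theorem abs_le_one_of_mem {x : ℝ} (hx : x ∈ Set.Icc (-1 : ℝ) 1) : |x| ≤ 1 := abs_le.mpr hx

/-- On the finite measure space `[-1, 1]`, continuous functions belong to `L²`. -/
theorem memLp_of_continuous {F : Type*} [NormedAddCommGroup F] {f : ℝ → F} (hf : Continuous f) :
    MemLp f 2 intervalMeasure := by
  obtain ⟨K, hK⟩ := (isCompact_Icc (a := (-1 : ℝ)) (b := 1)).exists_bound_of_continuousOn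
    hf.continuousOn
  refine MemLp.of_bound hf.aestronglyMeasurable.restrict K ?_
  filter_upwards [ae_intervalMeasure_mem] with x hx using hK x hx

/-- The monomial `x ^ n` as an element of `L²([-1, 1])`. -/
noncomputable def monomialLp (n : ℕ) : Lp ℝ 2 intervalMeasure :=
  (memLp_of_continuous (continuous_pow n)).toLp (fun x => x ^ n)

theorem monomialLp_ae (n : ℕ) : monomialLp n =ᵐ[intervalMeasure] fun x => x ^ n :=
  MemLp.coeFn_toLp _

theorem exists_norm_Lp_le_of_ae_le : ∃ K : ℝ, 0 ≤ K ∧ ∀ (F : Lp ℝ 2 intervalMeasure) (ε : ℝ),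
    0 ≤ ε → (∀ᵐ x ∂intervalMeasure, ‖F x‖ ≤ ε) → ‖F‖ ≤ K * ε :=
  ⟨_, by positivity, fun _ _ hε h => Lp.norm_le_of_ae_bound hε h⟩

theorem exists_norm_monomialLp_le : ∃ K : ℝ, 0 ≤ K ∧ ∀ n, ‖monomialLp n‖ ≤ K := by
  obtain ⟨K, hK0, hK⟩ := exists_norm_Lp_le_of_ae_le
  refine ⟨K, hK0, fun n => ?_⟩
  rw [← mul_one K]
  refine hK _ 1 zero_le_one ?_
  filter_upwards [monomialLp_ae n, ae_intervalMeasure_mem] with x hx hx1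
  rw [hx, norm_pow]
  exact pow_le_one₀ (norm_nonneg _) (abs_le_one_of_mem hx1)

theorem inner_monomialLp (n : ℕ) (f : Lp ℝ 2 intervalMeasure) :
    inner ℝ (monomialLp n) f = ∫ y in Set.Icc (-1 : ℝ) 1, y ^ n * f y := by
  rw [L2.inner_def]
  refine integral_congr_ae ?_
  filter_upwards [monomialLp_ae n] with x hx
  rw [hx]
  exact mul_comm _ _

theorem inner_monomialLp_monomialLp_of_odd {n k : ℕ} (h : Odd (n + k)) :
    inner ℝ (monomialLp n) (monomialLp k) = 0 := by
  have h1 : inner ℝ (monomialLp n) (monomialLp k)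
      = ∫ y in Set.Icc (-1 : ℝ) 1, y ^ (n + k) := by
    rw [inner_monomialLp]
    refine integral_congr_ae ?_
    filter_upwards [monomialLp_ae k] with x hx
    rw [hx, pow_add]
  rw [h1, integral_Icc_eq_integral_Ioc, ← intervalIntegral.integral_of_le (by norm_num),
    integral_pow, Even.neg_one_pow h.add_one]
  simp

theorem coeFn_sum_smul_monomialLp (c : ℕ → ℝ) (s : Finset ℕ) :
    (∑ n ∈ s, c n • monomialLp n : Lp ℝ 2 intervalMeasure) =ᵐ[intervalMeasure]
      fun x => ∑ n ∈ s, c n * x ^ n := by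
  induction s using Finset.induction_on with
  | empty =>
    simp only [Finset.sum_empty]
    exact Lp.coeFn_zero _ _ _
  | insert a s ha ih =>
    simp only [Finset.sum_insert ha]
    filter_upwards [ih, monomialLp_ae a, Lp.coeFn_smul (c a) (monomialLp a),
      Lp.coeFn_add (c a • monomialLp a) (∑ n ∈ s, c n • monomialLp n)] with x h1 h2 h3 h4
    rw [h4, Pi.add_apply, h3, Pi.smul_apply, h1, h2, smul_eq_mul]

/-- A power series converging absolutely at `1` that converges in `L²([-1, 1])` has the same sum
pointwise almost everywhere. -/
theorem ae_hasSum_of_hasSum_monomialLp {c : ℕ → ℝ} (hc : Summable fun n => |c n|)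
    {F : Lp ℝ 2 intervalMeasure} (h : HasSum (fun n => c n • monomialLp n) F) :
    ∀ᵐ x ∂intervalMeasure, HasSum (fun n => c n * x ^ n) (F x) := by
  have h1 : Tendsto (fun N => ∑ n ∈ Finset.range N, c n • monomialLp n) atTop (𝓝 F) :=
    h.tendsto_sum_nat
  obtain ⟨φ, hφ, hlim⟩ := (tendstoInMeasure_of_tendsto_Lp h1).exists_seq_tendsto_ae
  have h2 : ∀ᵐ x ∂intervalMeasure, ∀ N,
      (∑ n ∈ Finset.range N, c n • monomialLp n : Lp ℝ 2 intervalMeasure) x =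
        ∑ n ∈ Finset.range N, c n * x ^ n :=
    ae_all_iff.mpr fun N => coeFn_sum_smul_monomialLp c _
  filter_upwards [hlim, h2, ae_intervalMeasure_mem] with x hx hx2 hx1
  have hs : Summable fun n => c n * x ^ n := by
    refine Summable.of_norm_bounded hc fun n => ?_
    rw [norm_mul, norm_pow]
    exact mul_le_of_le_one_right (norm_nonneg _)
      (pow_le_one₀ (norm_nonneg _) (abs_le_one_of_mem hx1))
  have h3 := (hs.hasSum.tendsto_sum_nat).comp hφ.tendsto_atTop
  have h4 : F x = ∑' n, c n * x ^ n := by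
    refine tendsto_nhds_unique hx ?_
    refine h3.congr fun N => ?_
    rw [hx2]
    rfl
  rw [h4]
  exact hs.hasSum

/-- A power series that converges absolutely at `1` and vanishes almost everywhere on `[-1, 1]` is
zero. -/
theorem coeff_eq_zero_of_ae_hasSum_zero {c : ℕ → ℝ} (hc : Summable fun n => |c n|)
    (h : ∀ᵐ x ∂intervalMeasure, HasSum (fun n => c n * x ^ n) 0) (n : ℕ) : c n = 0 := by
  have hb : ∀ x ∈ Set.Icc (-1 : ℝ) 1, ∀ n, ‖c n * x ^ n‖ ≤ |c n| := by
    intro x hx n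
    rw [norm_mul, norm_pow]
    exact mul_le_of_le_one_right (norm_nonneg _)
      (pow_le_one₀ (norm_nonneg _) (abs_le_one_of_mem hx))
  have hcont : ContinuousOn (fun x => ∑' n, c n * x ^ n) (Set.Icc (-1 : ℝ) 1) :=
    continuousOn_tsum (fun n => (continuous_const.mul (continuous_pow n)).continuousOn) hc
      fun n x hx => hb x hx n
  have hzero : Set.EqOn (fun x => ∑' n, c n * x ^ n) (fun _ => 0) (Set.Icc (-1 : ℝ) 1) := by
    refine Measure.eqOn_Icc_of_ae_eq (μ := volume) (by norm_num) ?_ hcont continuousOn_const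
    filter_upwards [h] with x hx using hx.tsum_eq
  have hser : HasFPowerSeriesAt (0 : ℝ → ℝ) (FormalMultilinearSeries.ofScalars ℝ c) 0 := by
    rw [hasFPowerSeriesAt_iff]
    filter_upwards [Icc_mem_nhds (by norm_num : (-1 : ℝ) < 0) one_pos] with x hx
    have hs : Summable fun n => c n * x ^ n := Summable.of_norm_bounded hc (hb x hx)
    have h1 := hs.hasSum
    rw [show (∑' n, c n * x ^ n) = 0 from hzero hx] at h1
    simpa [FormalMultilinearSeries.coeff_ofScalars, mul_comm] using h1
  have h2 := FormalMultilinearSeries.coeff_ofScalars (𝕜 := ℝ) (p := c) (n := n)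
  rw [← h2, hser.eq_zero]
  rfl

theorem linearIndependent_monomialLp : LinearIndependent ℝ monomialLp := by
  rw [linearIndependent_iff']
  intro s g hg i hi
  let c : ℕ → ℝ := fun n => if n ∈ s then g n else 0
  have hc : Summable fun n => |c n| :=
    summable_of_ne_finset_zero (s := s) fun n hn => by simp [c, hn]
  have h1 : ∀ᵐ x ∂intervalMeasure, HasSum (fun n => c n * x ^ n) 0 := by
    have h2 := coeFn_sum_smul_monomialLp g s
    rw [hg] at h2
    filter_upwards [h2, Lp.coeFn_zero ℝ 2 intervalMeasure] with x hx hx0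
    rw [hx0] at hx
    have h3 : HasSum (fun n => c n * x ^ n) (∑ n ∈ s, c n * x ^ n) :=
      hasSum_sum_of_ne_finset_zero fun n hn => by simp [c, hn]
    have h4 : ∑ n ∈ s, c n * x ^ n = 0 := by
      rw [show (0 : ℝ) = (0 : ℝ → ℝ) x from rfl, hx]
      exact Finset.sum_congr rfl fun n hn => by simp [c, hn]
    rwa [h4] at h3
  simpa [c, hi] using coeff_eq_zero_of_ae_hasSum_zero hc h1 i

theorem not_finiteDimensional_Lp : ¬ FiniteDimensional ℝ (Lp ℝ 2 intervalMeasure) := by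
  intro h
  exact (inferInstance : Infinite ℕ).not_finite linearIndependent_monomialLp.finite

/-- Weierstrass: an element of `L²([-1, 1])` with vanishing moments is zero. -/
theorem eq_zero_of_moments_eq_zero {f : Lp ℝ 2 intervalMeasure}
    (hf : ∀ n, inner ℝ (monomialLp n) f = 0) : f = 0 := by
  obtain ⟨K, hK0, hK⟩ := exists_norm_Lp_le_of_ae_le
  have hsmall : ∀ ε > 0, ‖f‖ ≤ ε + K * ε := by
    intro ε hε
    obtain ⟨g, hg, hgm⟩ := (Lp.memLp f).exists_boundedContinuous_eLpNorm_sub_le (by norm_num)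
      (ε := ENNReal.ofReal ε) (by simpa using hε)
    obtain ⟨p, hp⟩ := exists_polynomial_near_of_continuousOn (-1) 1 g g.continuous.continuousOn ε hε
    have hpm : MemLp (fun x => p.eval x) 2 intervalMeasure := memLp_of_continuous p.continuous
    have hp_eq : hpm.toLp = ∑ n ∈ p.support, p.coeff n • monomialLp n := by
      refine Lp.ext ?_
      filter_upwards [hpm.coeFn_toLp, coeFn_sum_smul_monomialLp p.coeff p.support] with x h1 h2
      rw [h1, h2, Polynomial.eval_eq_sum, Polynomial.sum]
    have h0 : inner ℝ hpm.toLp f = 0 := by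
      rw [hp_eq, sum_inner]
      refine Finset.sum_eq_zero fun n _ => ?_
      rw [real_inner_smul_left, hf, mul_zero]
    have h1 : ‖f - hgm.toLp‖ ≤ ε := by
      have : f - hgm.toLp = ((Lp.memLp f).sub hgm).toLp := by
        rw [MemLp.toLp_sub (Lp.memLp f) hgm, Lp.toLp_coeFn]
      rw [this, Lp.norm_toLp]
      exact ENNReal.toReal_le_of_le_ofReal hε.le hg
    have h2 : ‖hgm.toLp - hpm.toLp‖ ≤ K * ε := by
      refine hK _ ε hε.le ?_
      filter_upwards [Lp.coeFn_sub hgm.toLp hpm.toLp, hgm.coeFn_toLp, hpm.coeFn_toLp,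
        ae_intervalMeasure_mem] with x e1 e2 e3 hx
      rw [e1, Pi.sub_apply, e2, e3, norm_sub_rev]
      exact (hp x hx).le
    have h3 : ‖f‖ * ‖f‖ ≤ ‖f - hpm.toLp‖ * ‖f‖ := by
      have h4 : inner ℝ (f - hpm.toLp) f = ‖f‖ * ‖f‖ := by
        rw [inner_sub_left, h0, sub_zero, real_inner_self_eq_norm_mul_norm]
      rw [← h4]
      exact real_inner_le_norm _ _
    have h5 : ‖f - hpm.toLp‖ ≤ ε + K * ε := by
      rw [← sub_add_sub_cancel f hgm.toLp hpm.toLp]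
      exact (norm_add_le _ _).trans (add_le_add h1 h2)
    rcases (norm_nonneg f).eq_or_lt with h6 | h6
    · rw [← h6]
      positivity
    · exact (le_of_mul_le_mul_right h3 h6).trans h5
  have hlim : Tendsto (fun ε : ℝ => ε + K * ε) (𝓝[>] 0) (𝓝 0) := by
    have : Tendsto (fun ε : ℝ => ε + K * ε) (𝓝 0) (𝓝 (0 + K * 0)) :=
      (continuous_id.add (continuous_const.mul continuous_id)).tendsto 0
    rw [mul_zero, add_zero] at this
    exact this.mono_left nhdsWithin_le_nhds
  exact norm_le_zero_iff.mp (ge_of_tendsto hlim (eventually_nhdsWithin_of_forall hsmall))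

/-- The operator `∑ a_n ⟨x ^ n, ·⟩ x ^ n` on `L²([-1, 1])`, i.e. the integral operator with kernel
`∑ a_n (x y) ^ n`. -/
noncomputable def taylorOp (a : ℕ → ℝ) : Lp ℝ 2 intervalMeasure →L[ℝ] Lp ℝ 2 intervalMeasure :=
  ∑' n, a n • InnerProductSpace.rankOne ℝ (monomialLp n) (monomialLp n)

section TaylorOp

variable {a : ℕ → ℝ} (ha : Summable fun n => |a n|)

include ha

theorem hasSum_taylorOp :
    HasSum (fun n => a n • InnerProductSpace.rankOne ℝ (monomialLp n) (monomialLp n))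
      (taylorOp a) := by
  obtain ⟨K, hK0, hK⟩ := exists_norm_monomialLp_le
  refine Summable.hasSum (Summable.of_norm_bounded (ha.mul_right (K * K)) fun n => ?_)
  rw [norm_smul, InnerProductSpace.norm_rankOne, Real.norm_eq_abs]
  gcongr <;> exact hK n

theorem hasSum_taylorOp_apply (f : Lp ℝ 2 intervalMeasure) :
    HasSum (fun n => (a n * inner ℝ (monomialLp n) f) • monomialLp n) (taylorOp a f) := by
  have h := (hasSum_taylorOp ha).mapL (ContinuousLinearMap.apply ℝ (Lp ℝ 2 intervalMeasure) f)
  simpa [smul_smul] using h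

theorem summable_coeff_mul_inner (f : Lp ℝ 2 intervalMeasure) :
    Summable fun n => |a n * inner ℝ (monomialLp n) f| := by
  obtain ⟨K, hK0, hK⟩ := exists_norm_monomialLp_le
  refine Summable.of_nonneg_of_le (fun _ => abs_nonneg _) (fun n => ?_)
    (ha.mul_right (K * ‖f‖))
  rw [abs_mul]
  gcongr
  exact (abs_real_inner_le_norm _ _).trans (by gcongr; exact hK n)

theorem hasSum_inner_taylorOp (g f : Lp ℝ 2 intervalMeasure) :
    HasSum (fun n => a n * inner ℝ (monomialLp n) f * inner ℝ g (monomialLp n))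
      (inner ℝ g (taylorOp a f)) := by
  have h := (hasSum_taylorOp_apply ha f).mapL (innerSL ℝ g)
  simpa [inner_smul_right] using h

theorem isSymmetric_taylorOp : (taylorOp a).IsSymmetric := by
  intro g f
  have h1 := hasSum_inner_taylorOp ha f g
  have h2 := hasSum_inner_taylorOp ha g f
  rw [real_inner_comm] at h1
  refine h1.unique (h2.congr_fun ?_)
  intro n
  rw [real_inner_comm g, real_inner_comm f]
  ring

theorem isCompactOperator_taylorOp : IsCompactOperator (taylorOp a) := by
  refine isCompactOperator_of_tendsto (hasSum_taylorOp ha).tendsto_sum_nat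
    (Eventually.of_forall fun N => ?_)
  induction N with
  | zero => simpa using isCompactOperator_zero
  | succ N ih =>
    rw [Finset.sum_range_succ]
    refine ih.add (IsCompactOperator.smul ?_ (a N))
    rw [InnerProductSpace.rankOne_def']
    exact (isCompactOperator_of_locallyCompactSpace_dom (innerSL ℝ (monomialLp N))).clm_comp
      (ContinuousLinearMap.toSpanSingleton ℝ (monomialLp N))

theorem coeff_mul_inner_eq_zero_of_taylorOp_eq_zero {f : Lp ℝ 2 intervalMeasure}
    (h : taylorOp a f = 0) (n : ℕ) : a n * inner ℝ (monomialLp n) f = 0 := by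
  have hs := summable_coeff_mul_inner ha f
  have h1 := hasSum_taylorOp_apply ha f
  rw [h] at h1
  refine coeff_eq_zero_of_ae_hasSum_zero hs ?_ n
  filter_upwards [ae_hasSum_of_hasSum_monomialLp hs h1, Lp.coeFn_zero ℝ 2 intervalMeasure]
    with x hx hx0
  rwa [hx0] at hx

theorem taylorOp_taylorOp_eq_zero {b : ℕ → ℝ} (hb : Summable fun n => |b n|)
    (hab : ∀ n k, a n * b k ≠ 0 → Odd (n + k)) (f : Lp ℝ 2 intervalMeasure) :
    taylorOp a (taylorOp b f) = 0 := by
  have h0 : ∀ n, a n * inner ℝ (monomialLp n) (taylorOp b f) = 0 := by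
    intro n
    have h1 := (hasSum_inner_taylorOp hb (monomialLp n) f).mul_left (a n)
    refine h1.unique ?_
    convert! hasSum_zero using 2 with k
    by_cases hk : a n * b k = 0
    · rw [show ∀ u w : ℝ, a n * (b k * u * w) = a n * b k * (u * w) from fun u w => by ring, hk,
        zero_mul]
    · rw [inner_monomialLp_monomialLp_of_odd (hab n k hk), mul_zero, mul_zero]
  have h2 := hasSum_taylorOp_apply ha (taylorOp b f)
  simp only [h0, zero_smul] at h2
  exact h2.unique hasSum_zero

theorem taylorOp_ae {k : ℝ → ℝ} (hk : ∀ t, |t| ≤ 1 → HasSum (fun n => a n * t ^ n) (k t))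
    (f : Lp ℝ 2 intervalMeasure) :
    taylorOp a f =ᵐ[intervalMeasure]
      fun x => ∫ y in Set.Icc (-1 : ℝ) 1, k (x * y) * f y := by
  have hs := summable_coeff_mul_inner ha f
  have hfi : Integrable f intervalMeasure := (Lp.memLp f).integrable (by norm_num)
  filter_upwards [ae_hasSum_of_hasSum_monomialLp hs (hasSum_taylorOp_apply ha f),
    ae_intervalMeasure_mem] with x hx hx1
  refine hx.unique ?_
  have h1 : HasSum (fun n => ∫ y in Set.Icc (-1 : ℝ) 1, a n * (x * y) ^ n * f y)
      (∫ y in Set.Icc (-1 : ℝ) 1, k (x * y) * f y) := by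
    refine hasSum_integral_of_dominated_convergence (fun n y => |a n| * |f y|) ?_ ?_ ?_ ?_ ?_
    · intro n
      exact ((by fun_prop : Continuous fun y : ℝ => a n * (x * y) ^ n).aestronglyMeasurable).mul
        hfi.aestronglyMeasurable
    · intro n
      filter_upwards [ae_intervalMeasure_mem] with y hy
      rw [norm_mul, norm_mul, norm_pow, Real.norm_eq_abs, Real.norm_eq_abs, Real.norm_eq_abs]
      have : |x * y| ≤ 1 := by
        rw [abs_mul]
        exact mul_le_one₀ (abs_le_one_of_mem hx1) (abs_nonneg _) (abs_le_one_of_mem hy)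
      gcongr
      exact mul_le_of_le_one_right (abs_nonneg _) (pow_le_one₀ (abs_nonneg _) this)
    · exact Eventually.of_forall fun y => ha.mul_right _
    · simp_rw [tsum_mul_right]
      exact hfi.abs.const_mul _
    · filter_upwards [ae_intervalMeasure_mem] with y hy
      have : |x * y| ≤ 1 := by
        rw [abs_mul]
        exact mul_le_one₀ (abs_le_one_of_mem hx1) (abs_nonneg _) (abs_le_one_of_mem hy)
      exact (hk _ this).mul_right _
  refine h1.congr_fun fun n => ?_
  rw [inner_monomialLp, mul_right_comm, mul_assoc, ← integral_const_mul, ← integral_const_mul]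
  congr 1
  ext y
  rw [mul_pow]
  ring

end TaylorOp

/-! ### The cosine and sine parts of the band-limited Fourier operator -/

/-- Taylor coefficients of `t ↦ Re e^{ict} = cos (c t)`. -/
noncomputable def cosCoeff (c : ℝ) (n : ℕ) : ℝ := c ^ n * (Complex.I ^ n).re / n.factorial

/-- Taylor coefficients of `t ↦ Im e^{ict} = sin (c t)`. -/
noncomputable def sinCoeff (c : ℝ) (n : ℕ) : ℝ := c ^ n * (Complex.I ^ n).im / n.factorial

theorem summable_cosCoeff (c : ℝ) : Summable fun n => |cosCoeff c n| := by
  refine Summable.of_nonneg_of_le (fun _ => abs_nonneg _) (fun n => ?_)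
    (Real.summable_pow_div_factorial |c|)
  rw [cosCoeff, abs_div, abs_mul, abs_pow, Nat.abs_cast]
  gcongr
  refine mul_le_of_le_one_right (by positivity) ((Complex.abs_re_le_norm _).trans ?_)
  simp

theorem summable_sinCoeff (c : ℝ) : Summable fun n => |sinCoeff c n| := by
  refine Summable.of_nonneg_of_le (fun _ => abs_nonneg _) (fun n => ?_)
    (Real.summable_pow_div_factorial |c|)
  rw [sinCoeff, abs_div, abs_mul, abs_pow, Nat.abs_cast]
  gcongr
  refine mul_le_of_le_one_right (by positivity) ((Complex.abs_im_le_norm _).trans ?_)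
  simp

theorem hasSum_exp_I_mul (c t : ℝ) :
    HasSum (fun n : ℕ => Complex.I ^ n * ((c ^ n * t ^ n / n.factorial : ℝ) : ℂ))
      (Complex.exp (Complex.I * ((c * t : ℝ) : ℂ))) := by
  have h := NormedSpace.expSeries_div_hasSum_exp (𝔸 := ℂ) (Complex.I * ((c * t : ℝ) : ℂ))
  rw [← Complex.exp_eq_exp_ℂ] at h
  refine h.congr_fun fun n => ?_
  push_cast
  rw [mul_pow, mul_pow]
  ring

theorem hasSum_cosCoeff (c t : ℝ) : HasSum (fun n => cosCoeff c n * t ^ n)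
    (Complex.exp (Complex.I * ((c * t : ℝ) : ℂ))).re := by
  refine (Complex.hasSum_re (hasSum_exp_I_mul c t)).congr_fun fun n => ?_
  rw [Complex.re_mul_ofReal, cosCoeff]
  ring

theorem hasSum_sinCoeff (c t : ℝ) : HasSum (fun n => sinCoeff c n * t ^ n)
    (Complex.exp (Complex.I * ((c * t : ℝ) : ℂ))).im := by
  refine (Complex.hasSum_im (hasSum_exp_I_mul c t)).congr_fun fun n => ?_
  rw [Complex.im_mul_ofReal, sinCoeff]
  ring

theorem cosCoeff_of_odd (c : ℝ) {n : ℕ} (h : Odd n) : cosCoeff c n = 0 := by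
  obtain ⟨k, rfl⟩ := h
  have : (Complex.I ^ (2 * k + 1)).re = 0 := by
    rw [pow_succ, pow_mul, Complex.I_sq]
    have : ((-1 : ℂ)) ^ k = (((-1 : ℝ) ^ k : ℝ) : ℂ) := by push_cast; rfl
    rw [this, Complex.re_ofReal_mul]
    simp
  rw [cosCoeff, this]
  simp

theorem sinCoeff_of_even (c : ℝ) {n : ℕ} (h : Even n) : sinCoeff c n = 0 := by
  obtain ⟨k, rfl⟩ := h
  have : (Complex.I ^ (k + k)).im = 0 := by
    rw [← two_mul, pow_mul, Complex.I_sq]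
    have : ((-1 : ℂ)) ^ k = (((-1 : ℝ) ^ k : ℝ) : ℂ) := by push_cast; rfl
    rw [this, Complex.ofReal_im]
  rw [sinCoeff, this]
  simp

theorem odd_add_of_coeff_mul_ne_zero (c : ℝ) (n k : ℕ) (h : cosCoeff c n * sinCoeff c k ≠ 0) :
    Odd (n + k) := by
  have hn : Even n := by
    by_contra hn
    exact h (by rw [cosCoeff_of_odd c (Nat.not_even_iff_odd.mp hn), zero_mul])
  have hk : Odd k := by
    by_contra hk
    exact h (by rw [sinCoeff_of_even c (Nat.not_odd_iff_even.mp hk), mul_zero])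
  exact hn.add_odd hk

theorem cosCoeff_ne_zero_or_sinCoeff_ne_zero {c : ℝ} (hc : c ≠ 0) (n : ℕ) :
    cosCoeff c n ≠ 0 ∨ sinCoeff c n ≠ 0 := by
  by_contra! h
  have hf : (n.factorial : ℝ) ≠ 0 := by positivity
  rw [cosCoeff, sinCoeff, div_eq_zero_iff, div_eq_zero_iff, mul_eq_zero, mul_eq_zero] at h
  have h1 := (h.1.resolve_right hf).resolve_left (pow_ne_zero n hc)
  have h2 := (h.2.resolve_right hf).resolve_left (pow_ne_zero n hc)
  exact pow_ne_zero n Complex.I_ne_zero (Complex.ext h1 h2)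

theorem isSplitPair_taylorOp {c : ℝ} (hc : c ≠ 0) :
    IsSplitPair (taylorOp (cosCoeff c)) (taylorOp (sinCoeff c)) where
  compact_left := isCompactOperator_taylorOp (summable_cosCoeff c)
  compact_right := isCompactOperator_taylorOp (summable_sinCoeff c)
  symm_left := isSymmetric_taylorOp (summable_cosCoeff c)
  symm_right := isSymmetric_taylorOp (summable_sinCoeff c)
  left_right := taylorOp_taylorOp_eq_zero (summable_cosCoeff c) (summable_sinCoeff c)
    (odd_add_of_coeff_mul_ne_zero c)
  right_left := taylorOp_taylorOp_eq_zero (summable_sinCoeff c) (summable_cosCoeff c)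
    fun n k h => by
      rw [add_comm]
      exact odd_add_of_coeff_mul_ne_zero c k n (by rwa [mul_comm])
  injective := fun u h1 h2 => eq_zero_of_moments_eq_zero fun n => by
    have e1 := coeff_mul_inner_eq_zero_of_taylorOp_eq_zero (summable_cosCoeff c) h1 n
    have e2 := coeff_mul_inner_eq_zero_of_taylorOp_eq_zero (summable_sinCoeff c) h2 n
    rcases cosCoeff_ne_zero_or_sinCoeff_ne_zero hc n with h | h
    · exact (mul_eq_zero.mp e1).resolve_left h
    · exact (mul_eq_zero.mp e2).resolve_left h

/-! ### Elementary properties of the band-limited Fourier operator -/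

theorem norm_exp_I_mul (t : ℝ) : ‖Complex.exp (Complex.I * (t : ℂ))‖ = 1 := by
  rw [mul_comm]
  exact Complex.norm_exp_ofReal_mul_I t

theorem bandOp_congr {c : ℝ} {f g : ℝ → ℂ} (h : f =ᵐ[intervalMeasure] g) :
    bandOp c f = bandOp c g := by
  ext x
  refine integral_congr_ae ?_
  filter_upwards [h] with y hy
  rw [hy]

theorem integrable_exp_mul {f : ℝ → ℂ} {μ : Measure ℝ} (hf : Integrable f μ) (a : ℝ) :
    Integrable (fun y : ℝ => Complex.exp (Complex.I * ((a * y : ℝ) : ℂ)) * f y) μ := by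
  refine hf.bdd_mul (c := 1) (by fun_prop : Continuous _).aestronglyMeasurable ?_
  exact Eventually.of_forall fun y => (norm_exp_I_mul _).le

theorem continuous_bandOp {c : ℝ} {f : ℝ → ℂ} (hf : Integrable f intervalMeasure) :
    Continuous (bandOp c f) := by
  refine continuous_of_dominated (bound := fun y => ‖f y‖) ?_ ?_ hf.norm ?_
  · intro x
    exact (integrable_exp_mul hf (c * x)).aestronglyMeasurable
  · intro x
    refine Eventually.of_forall fun y => ?_
    rw [norm_mul, norm_exp_I_mul, one_mul]
  · exact Eventually.of_forall fun y => by fun_prop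

theorem integrable_coeFn_Lp (f : Lp ℝ 2 intervalMeasure) : Integrable f intervalMeasure :=
  (Lp.memLp f).integrable (by norm_num)

theorem bandOp_ofReal_ae (c : ℝ) (f : Lp ℝ 2 intervalMeasure) :
    bandOp c (fun y => (f y : ℂ)) =ᵐ[intervalMeasure]
      fun x => ⟨taylorOp (cosCoeff c) f x, taylorOp (sinCoeff c) f x⟩ := by
  filter_upwards [taylorOp_ae (summable_cosCoeff c) (fun t _ => hasSum_cosCoeff c t) f,
    taylorOp_ae (summable_sinCoeff c) (fun t _ => hasSum_sinCoeff c t) f] with x h1 h2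
  have hi := integrable_exp_mul (integrable_coeFn_Lp f).ofReal (c * x) (μ := intervalMeasure)
  refine Complex.ext ?_ ?_
  · rw [h1]
    refine (Complex.reCLM.integral_comp_comm hi).symm.trans ?_
    refine integral_congr_ae (Eventually.of_forall fun y => ?_)
    simp only [Complex.reCLM_apply, ← mul_assoc]
    exact Complex.re_mul_ofReal _ _
  · rw [h2]
    refine (Complex.imCLM.integral_comp_comm hi).symm.trans ?_
    refine integral_congr_ae (Eventually.of_forall fun y => ?_)
    simp only [Complex.imCLM_apply, ← mul_assoc]
    exact Complex.im_mul_ofReal _ _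

/-- Real eigenfunctions of the band-limited Fourier operator are the joint eigenvectors of its
cosine and sine parts. -/
theorem joint_eigenvector_iff {c : ℝ} {f : Lp ℝ 2 intervalMeasure} {l : ℂ} :
    (taylorOp (cosCoeff c) f = l.re • f ∧ taylorOp (sinCoeff c) f = l.im • f) ↔
      bandOp c (fun y => (f y : ℂ)) =ᵐ[intervalMeasure] fun x => l * (f x : ℂ) := by
  have h0 := bandOp_ofReal_ae c f
  constructor
  · rintro ⟨h1, h2⟩
    rw [h1, h2] at h0
    filter_upwards [h0, Lp.coeFn_smul l.re f, Lp.coeFn_smul l.im f] with x e0 e1 e2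
    rw [e0, e1, e2]
    refine Complex.ext ?_ ?_
    · rw [Complex.re_mul_ofReal]; rfl
    · rw [Complex.im_mul_ofReal]; rfl
  · intro h
    constructor
    · refine Lp.ext ?_
      filter_upwards [h, h0, Lp.coeFn_smul l.re f] with x e e0 e1
      rw [e0] at e
      rw [e1, Pi.smul_apply, smul_eq_mul, ← Complex.re_mul_ofReal, ← e]
    · refine Lp.ext ?_
      filter_upwards [h, h0, Lp.coeFn_smul l.im f] with x e e0 e1
      rw [e0] at e
      rw [e1, Pi.smul_apply, smul_eq_mul, ← Complex.im_mul_ofReal, ← e]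

/-- If a family of real functions is total in real `L²([-1, 1])`, it is total in the complex
space. -/
theorem ae_eq_zero_of_total {ψ : ℕ → ℝ → ℝ} (hψ : ∀ j, MemLp (ψ j) 2 intervalMeasure)
    (htot : ∀ u : Lp ℝ 2 intervalMeasure, (∀ j, inner ℝ (hψ j).toLp u = 0) → u = 0)
    {h : ℝ → ℂ} (hh : MemLp h 2 intervalMeasure)
    (horth : ∀ j, ∫ y in Set.Icc (-1 : ℝ) 1, (ψ j y : ℂ) * h y = 0) :
    h =ᵐ[intervalMeasure] 0 := by
  have hint : ∀ j, Integrable (fun y => (ψ j y : ℂ) * h y) intervalMeasure := fun j =>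
    (hψ j).ofReal.integrable_mul hh
  have hre : hh.re.toLp = 0 := by
    refine htot _ fun j => ?_
    have h1 := Complex.reCLM.integral_comp_comm (hint j)
    rw [show ∫ y, (ψ j y : ℂ) * h y ∂intervalMeasure = 0 from horth j, map_zero] at h1
    rw [← h1, L2.inner_def]
    refine integral_congr_ae ?_
    filter_upwards [(hψ j).coeFn_toLp, hh.re.coeFn_toLp] with y e1 e2
    rw [e1, e2, Complex.reCLM_apply, Complex.re_ofReal_mul]
    exact mul_comm _ _
  have him : hh.im.toLp = 0 := by
    refine htot _ fun j => ?_
    have h1 := Complex.imCLM.integral_comp_comm (hint j)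
    rw [show ∫ y, (ψ j y : ℂ) * h y ∂intervalMeasure = 0 from horth j, map_zero] at h1
    rw [← h1, L2.inner_def]
    refine integral_congr_ae ?_
    filter_upwards [(hψ j).coeFn_toLp, hh.im.coeFn_toLp] with y e1 e2
    rw [e1, e2, Complex.imCLM_apply, Complex.im_ofReal_mul]
    exact mul_comm _ _
  filter_upwards [hh.re.coeFn_toLp, hh.im.coeFn_toLp, Lp.coeFn_zero ℝ 2 intervalMeasure]
    with y e1 e2 e0
  rw [hre, e0] at e1
  rw [him, e0] at e2
  exact Complex.ext e1.symm e2.symm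

/-! ### Existence and completeness of prolate spheroidal wave functions -/

/-- An eigenfunction in the almost-everywhere sense, with non-zero eigenvalue, has a continuous
representative for which the eigenvalue equation holds at every point of `[-1, 1]`. -/
theorem bandOp_div_eigen {c : ℝ} {f : ℝ → ℂ} {l : ℂ} (hl : l ≠ 0)
    (h : bandOp c f =ᵐ[intervalMeasure] fun x => l * f x) :
    (fun x => bandOp c f x / l) =ᵐ[intervalMeasure] f ∧
      ∀ x, bandOp c (fun y => bandOp c f y / l) x = l * (bandOp c f x / l) := by
  have h1 : (fun x => bandOp c f x / l) =ᵐ[intervalMeasure] f := by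
    filter_upwards [h] with x hx
    rw [hx, mul_div_cancel_left₀ _ hl]
  exact ⟨h1, fun x => by rw [bandOp_congr h1, mul_div_cancel₀ _ hl]⟩

theorem exists_isPSWF {c : ℝ} (hc : c ≠ 0) : ∃ (ψ : ℕ → ℝ → ℝ) (μ : ℕ → ℂ), IsPSWF c ψ μ := by
  have hpair := isSplitPair_taylorOp hc
  obtain ⟨f, l, hon, heig, hanti, htot⟩ :=
    exists_orthonormal_joint_eigenvectors not_finiteDimensional_Lp hpair
  have hl : ∀ n, l n ≠ 0 := by
    intro n h0
    have h1 : f n = 0 := by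
      refine hpair.injective _ ?_ ?_
      · rw [(heig n).1, h0, Complex.zero_re, zero_smul]
      · rw [(heig n).2, h0, Complex.zero_im, zero_smul]
    have h2 := hon.1 n
    rw [h1, norm_zero] at h2
    exact zero_ne_one h2
  have hfi : ∀ n, Integrable (fun y => (f n y : ℂ)) intervalMeasure := fun n =>
    (integrable_coeFn_Lp (f n)).ofReal
  have hae : ∀ n, bandOp c (fun y => (f n y : ℂ)) =ᵐ[intervalMeasure] fun x => l n * (f n x : ℂ) :=
    fun n => joint_eigenvector_iff.mp (heig n)
  let ψ : ℕ → ℝ → ℝ := fun n x => (bandOp c (fun y => (f n y : ℂ)) x / l n).re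
  have hcont : ∀ n, Continuous (ψ n) := fun n =>
    Complex.continuous_re.comp ((continuous_bandOp (hfi n)).div_const _)
  have hψf : ∀ n, ψ n =ᵐ[intervalMeasure] f n := by
    intro n
    filter_upwards [(bandOp_div_eigen (hl n) (hae n)).1] with x hx
    simp only [ψ]
    rw [hx, Complex.ofReal_re]
  have hψm : ∀ n, MemLp (ψ n) 2 intervalMeasure := fun n => memLp_of_continuous (hcont n)
  have hψLp : ∀ n, (hψm n).toLp = f n := fun n => by
    rw [← Lp.toLp_coeFn (f n) (Lp.memLp (f n))]
    exact MemLp.toLp_congr _ _ (hψf n)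
  refine ⟨ψ, l, hψm, fun i j => ?_, fun j => ?_, hanti, fun h lam hh _ horth => ?_⟩
  · have h1 := (orthonormal_iff_ite.mp hon) i j
    rw [L2.inner_def] at h1
    rw [← h1]
    refine integral_congr_ae ?_
    filter_upwards [hψf i, hψf j] with y e1 e2
    rw [e1, e2]
    exact mul_comm _ _
  · have h1 : (fun y => (ψ j y : ℂ)) =ᵐ[intervalMeasure] fun y => (f j y : ℂ) := by
      filter_upwards [hψf j] with y hy
      rw [hy]
    rw [bandOp_congr h1]
    -- both sides are continuous and agree almost everywhere
    refine Measure.eqOn_Icc_of_ae_eq (μ := volume) (by norm_num) ?_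
      (continuous_bandOp (hfi j)).continuousOn
      (continuous_const.mul (Complex.continuous_ofReal.comp (hcont j))).continuousOn
    refine (hae j).trans ?_
    filter_upwards [hψf j] with y hy
    simp only [hy]
  · refine ae_eq_zero_of_total hψm (fun u hu => htot u fun n => ?_) hh horth
    rw [← hψLp]
    exact hu n

section IsPSWF

variable {c : ℝ} {ψ : ℕ → ℝ → ℝ} {μ : ℕ → ℂ}

theorem IsPSWF.eigen_Lp (h : IsPSWF c ψ μ) (j : ℕ) :
    taylorOp (cosCoeff c) (h.memLp j).toLp = (μ j).re • (h.memLp j).toLp ∧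
      taylorOp (sinCoeff c) (h.memLp j).toLp = (μ j).im • (h.memLp j).toLp := by
  refine joint_eigenvector_iff.mpr ?_
  have h1 : (fun y => ((h.memLp j).toLp (ψ j) y : ℂ)) =ᵐ[intervalMeasure] fun y => (ψ j y : ℂ) := by
    filter_upwards [(h.memLp j).coeFn_toLp] with y hy
    rw [hy]
  rw [bandOp_congr h1]
  filter_upwards [(h.memLp j).coeFn_toLp, ae_intervalMeasure_mem] with x hx hx1
  rw [hx, h.eigen j x hx1]

theorem IsPSWF.orthonormal_Lp (h : IsPSWF c ψ μ) :
    Orthonormal ℝ fun j => (h.memLp j).toLp := by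
  rw [orthonormal_iff_ite]
  intro i j
  rw [← h.orthonormal i j, L2.inner_def]
  refine integral_congr_ae ?_
  filter_upwards [(h.memLp i).coeFn_toLp, (h.memLp j).coeFn_toLp] with y e1 e2
  rw [e1, e2]
  exact mul_comm _ _

theorem IsPSWF.eigenvalue_ne_zero (h : IsPSWF c ψ μ) (hc : c ≠ 0) (j : ℕ) : μ j ≠ 0 := by
  intro h0
  obtain ⟨h1, h2⟩ := h.eigen_Lp j
  rw [h0, Complex.zero_re, zero_smul] at h1
  rw [h0, Complex.zero_im, zero_smul] at h2
  have h3 := h.orthonormal_Lp.1 j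
  simp only [(isSplitPair_taylorOp hc).injective _ h1 h2, norm_zero] at h3
  exact zero_ne_one h3

/-- The span of the wave functions is invariant under the cosine and sine parts, so by
`exists_joint_eigenvector` a non-trivial orthogonal complement would contain a further
eigenfunction, which the exhaustiveness condition rules out. -/
theorem IsPSWF.total (h : IsPSWF c ψ μ) (hc : c ≠ 0) (u : Lp ℝ 2 intervalMeasure)
    (hu : ∀ j, inner ℝ (h.memLp j).toLp u = 0) : u = 0 := by
  have hpair := isSplitPair_taylorOp hc
  set V : Submodule ℝ (Lp ℝ 2 intervalMeasure) :=
    Submodule.span ℝ (Set.range fun j => (h.memLp j).toLp) with hV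
  have hinv : ∀ (T : Lp ℝ 2 intervalMeasure →L[ℝ] Lp ℝ 2 intervalMeasure) (a : ℕ → ℝ),
      (∀ j, T (h.memLp j).toLp = a j • (h.memLp j).toLp) → ∀ w ∈ V, T w ∈ V := by
    intro T a hT w hw
    induction hw using Submodule.span_induction with
    | mem x hx =>
      obtain ⟨j, rfl⟩ := hx
      simp only [hT]
      exact V.smul_mem _ (Submodule.subset_span ⟨j, rfl⟩)
    | zero => rw [map_zero]; exact V.zero_mem
    | add x y _ _ hx hy => rw [map_add]; exact V.add_mem hx hy
    | smul b x _ hx => rw [map_smul]; exact V.smul_mem b hx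
  have hbot : Vᗮ = ⊥ := by
    by_contra hne
    obtain ⟨w, hw, hw1, l, h1, h2, -⟩ := exists_joint_eigenvector hpair
      (hinv _ _ fun j => (h.eigen_Lp j).1) (hinv _ _ fun j => (h.eigen_Lp j).2) hne
    have hw0 : w ≠ 0 := fun h0 => by simp [h0] at hw1
    have hl : l ≠ 0 := by
      rintro rfl
      exact hw0 (hpair.injective w (by simpa using h1) (by simpa using h2))
    have hwi : Integrable (fun y => (w y : ℂ)) intervalMeasure := (integrable_coeFn_Lp w).ofReal
    obtain ⟨e1, e2⟩ := bandOp_div_eigen hl (joint_eigenvector_iff.mp ⟨h1, h2⟩)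
    have h3 := h.exhaustive _ l (memLp_of_continuous ((continuous_bandOp hwi).div_const l))
      (fun x _ => e2 x) fun j => by
        have h4 : inner ℝ (h.memLp j).toLp w = 0 := hw _ (Submodule.subset_span ⟨j, rfl⟩)
        rw [L2.inner_def] at h4
        have h5 : ∫ y in Set.Icc (-1 : ℝ) 1, (ψ j y : ℂ) *
            (bandOp c (fun y => (w y : ℂ)) y / l)
            = ∫ y, ((inner ℝ ((h.memLp j).toLp (ψ j) y) (w y) : ℝ) : ℂ) ∂intervalMeasure := by
          refine integral_congr_ae ?_
          filter_upwards [e1, (h.memLp j).coeFn_toLp] with y g1 g2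
          rw [g1, g2, ← Complex.ofReal_mul]
          exact congrArg _ (mul_comm _ _)
        rw [h5, integral_complex_ofReal, h4, Complex.ofReal_zero]
    apply hw0
    refine Lp.ext ?_
    filter_upwards [e1, h3, Lp.coeFn_zero ℝ 2 intervalMeasure] with y g1 g2 g0
    rw [g2] at g1
    rw [g0]
    exact Complex.ofReal_eq_zero.mp g1.symm
  have hmem : u ∈ Vᗮ := by
    rw [hV, Submodule.mem_orthogonal]
    intro w hw
    induction hw using Submodule.span_induction with
    | mem x hx =>
      obtain ⟨j, rfl⟩ := hx
      exact hu j
    | zero => exact inner_zero_left _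
    | add x y _ _ hx hy => rw [inner_add_left, hx, hy, add_zero]
    | smul b x _ hx => rw [real_inner_smul_left, hx, mul_zero]
  rw [hbot] at hmem
  exact (Submodule.mem_bot ℝ).mp hmem

/-- The expansion of a complex-valued function in prolate spheroidal wave functions converges to
it in `L²([-1, 1])`. -/
theorem IsPSWF.tendsto_expansion (h : IsPSWF c ψ μ) (hc : c ≠ 0) {f : ℝ → ℂ}
    (hf : MemLp f 2 intervalMeasure) :
    Tendsto (fun n => eLpNorm (fun y => (∑ j ∈ Finset.range n,
      (∫ x in Set.Icc (-1 : ℝ) 1, (ψ j x : ℂ) * f x) * (ψ j y : ℂ)) - f y) 2 intervalMeasure)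
      atTop (𝓝 0) := by
  have hm : ∀ j, MemLp (fun y => (ψ j y : ℂ)) 2 intervalMeasure := fun j => (h.memLp j).ofReal
  let e : ℕ → Lp ℂ 2 intervalMeasure := fun j => (hm j).toLp
  have hinner : ∀ j (g : Lp ℂ 2 intervalMeasure),
      inner ℂ (e j) g = ∫ x in Set.Icc (-1 : ℝ) 1, (ψ j x : ℂ) * g x := by
    intro j g
    rw [L2.inner_def]
    refine integral_congr_ae ?_
    filter_upwards [(hm j).coeFn_toLp] with y e1
    simp only [e]
    rw [e1, RCLike.inner_apply, Complex.conj_ofReal, mul_comm]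
  have hon : Orthonormal ℂ e := by
    rw [orthonormal_iff_ite]
    intro i j
    rw [hinner]
    have h1 : ∫ x in Set.Icc (-1 : ℝ) 1, (ψ i x : ℂ) * e j x
        = ∫ x in Set.Icc (-1 : ℝ) 1, ((ψ i x * ψ j x : ℝ) : ℂ) := by
      refine integral_congr_ae ?_
      filter_upwards [(hm j).coeFn_toLp] with y e1
      rw [e1, Complex.ofReal_mul]
    rw [h1, integral_complex_ofReal, h.orthonormal]
    split_ifs <;> simp
  have hbot : (Submodule.span ℂ (Set.range e))ᗮ = ⊥ := by
    rw [Submodule.eq_bot_iff]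
    intro g hg
    refine Lp.ext ?_
    refine (ae_eq_zero_of_total h.memLp (h.total hc) (Lp.memLp g) fun j => ?_).trans
      (Lp.coeFn_zero ℂ 2 intervalMeasure).symm
    rw [← hinner]
    exact hg _ (Submodule.subset_span ⟨j, rfl⟩)
  let b := HilbertBasis.mkOfOrthogonalEqBot hon hbot
  have hb : ∀ j, b j = e j := fun j => by simp [b]
  have hsum := (b.hasSum_repr hf.toLp).tendsto_sum_nat
  rw [Lp.tendsto_Lp_iff_tendsto_eLpNorm'] at hsum
  refine hsum.congr fun n => eLpNorm_congr_ae ?_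
  have hcoef : ∀ j, b.repr hf.toLp j = ∫ x in Set.Icc (-1 : ℝ) 1, (ψ j x : ℂ) * f x := by
    intro j
    rw [b.repr_apply_apply, hb, hinner]
    refine integral_congr_ae ?_
    filter_upwards [hf.coeFn_toLp] with y e1
    rw [e1]
  simp only [hcoef, hb]
  have hpart : (∑ j ∈ Finset.range n, (∫ x in Set.Icc (-1 : ℝ) 1, (ψ j x : ℂ) * f x) • e j :
      Lp ℂ 2 intervalMeasure) =ᵐ[intervalMeasure] fun y => ∑ j ∈ Finset.range n,
        (∫ x in Set.Icc (-1 : ℝ) 1, (ψ j x : ℂ) * f x) * (ψ j y : ℂ) := by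
    induction n with
    | zero =>
      simp only [Finset.range_zero, Finset.sum_empty]
      exact Lp.coeFn_zero _ _ _
    | succ n ih =>
      simp only [Finset.sum_range_succ]
      refine (Lp.coeFn_add _ _).trans (ih.add ?_)
      refine (Lp.coeFn_smul _ _).trans ?_
      filter_upwards [(hm n).coeFn_toLp] with y e1
      simp only [Pi.smul_apply, smul_eq_mul, e]
      rw [e1]
  filter_upwards [hpart, hf.coeFn_toLp] with y e1 e2
  rw [Pi.sub_apply, e1, e2]

/-- The band-limited Fourier operator is symmetric for the bilinear pairing. -/
theorem integral_mul_bandOp (c : ℝ) {f g : ℝ → ℂ} (hf : Integrable f intervalMeasure)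
    (hg : Integrable g intervalMeasure) :
    ∫ x in Set.Icc (-1 : ℝ) 1, g x * bandOp c f x
      = ∫ y in Set.Icc (-1 : ℝ) 1, bandOp c g y * f y := by
  simp only [bandOp, ← integral_const_mul, ← integral_mul_const]
  rw [integral_integral_swap]
  · congr 1
    ext y
    congr 1
    ext x
    rw [mul_right_comm c y x]
    ring
  · have h1 : Integrable (fun p : ℝ × ℝ => g p.1 * f p.2)
      (intervalMeasure.prod intervalMeasure) := hg.mul_prod hf
    have h2 : Integrable (fun p : ℝ × ℝ =>
        Complex.exp (Complex.I * ((c * p.1 * p.2 : ℝ) : ℂ)) * (g p.1 * f p.2))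
        (intervalMeasure.prod intervalMeasure) := by
      refine h1.bdd_mul (c := 1) (by fun_prop : Continuous _).aestronglyMeasurable ?_
      exact Eventually.of_forall fun p => (norm_exp_I_mul _).le
    refine h2.congr (Eventually.of_forall fun p => ?_)
    simp only [Function.uncurry]
    ring

/-- If the data are the image of `f` under the band-limited Fourier operator, the inversion series
converges to `f`. -/
theorem IsPSWF.isBandInverse (h : IsPSWF c ψ μ) (hc : c ≠ 0) {f g : ℝ → ℂ}
    (hf : MemLp f 2 intervalMeasure)
    (hg : g =ᵐ[intervalMeasure] bandOp c f) :
    IsBandInverse ψ μ g f := by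
  have hfi : Integrable f intervalMeasure := hf.integrable (by norm_num)
  refine ⟨hf, (h.tendsto_expansion hc hf).congr fun n => ?_⟩
  congr 1
  ext y
  rw [inversePartialSum]
  congr 1
  refine Finset.sum_congr rfl fun j _ => ?_
  have hψi : Integrable (fun y => (ψ j y : ℂ)) intervalMeasure :=
    ((h.memLp j).integrable (by norm_num)).ofReal
  have h1 : ∫ x in Set.Icc (-1 : ℝ) 1, (ψ j x : ℂ) * g x
      = μ j * ∫ x in Set.Icc (-1 : ℝ) 1, (ψ j x : ℂ) * f x := by
    have h2 : ∫ x in Set.Icc (-1 : ℝ) 1, (ψ j x : ℂ) * g x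
        = ∫ x in Set.Icc (-1 : ℝ) 1, (ψ j x : ℂ) * bandOp c f x := by
      refine integral_congr_ae ?_
      filter_upwards [hg] with x hx
      rw [hx]
    rw [h2, integral_mul_bandOp c hfi hψi, ← integral_const_mul]
    refine setIntegral_congr_fun measurableSet_Icc fun x hx => ?_
    rw [h.eigen j x hx, mul_assoc]
  rw [h1]
  have := h.eigenvalue_ne_zero hc j
  field_simp

theorem IsBandInverse.ae_eq {g f f' : ℝ → ℂ} (hψ : ∀ j, MemLp (ψ j) 2 intervalMeasure)
    (h : IsBandInverse ψ μ g f) (h' : IsBandInverse ψ μ g f') :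
    f =ᵐ[intervalMeasure] f' := by
  have hpm : ∀ n, MemLp (inversePartialSum ψ μ g n) 2 intervalMeasure := by
    intro n
    unfold inversePartialSum
    refine memLp_finsetSum _ fun j _ => ?_
    exact ((hψ j).ofReal.const_mul (1 / μ j)).mul_const _
  have hle : ∀ n, eLpNorm (f - f') 2 intervalMeasure ≤
      eLpNorm (fun y => inversePartialSum ψ μ g n y - f y) 2 intervalMeasure +
        eLpNorm (fun y => inversePartialSum ψ μ g n y - f' y) 2 intervalMeasure := by
    intro n
    have e : f - f' = (f - inversePartialSum ψ μ g n) + (inversePartialSum ψ μ g n - f') := by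
      abel
    rw [e]
    refine (eLpNorm_add_le (h.1.sub (hpm n)).1 ((hpm n).sub h'.1).1 (by norm_num)).trans ?_
    rw [eLpNorm_sub_comm f]
    exact le_rfl
  have ht := h.2.add h'.2
  rw [add_zero] at ht
  have h0 : eLpNorm (f - f') 2 intervalMeasure = 0 :=
    le_antisymm (ge_of_tendsto' ht hle) zero_le
  rw [eLpNorm_eq_zero_iff (h.1.sub h'.1).1 (by norm_num)] at h0
  filter_upwards [h0] with q hq
  exact sub_eq_zero.mp hq

end IsPSWF

/-! ### Slices of square-integrable functions supported in the unit ball -/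

/-- The image of Lebesgue measure on the unit ball under an orthogonal projection to a line is
dominated by a multiple of Lebesgue measure on `[-1, 1]`: in orthonormal coordinates adapted to the
line, the ball is contained in the cube `[-1, 1] ^ d`. -/
theorem map_inner_restrict_ball_le {d : ℕ} {θ : Space d} (hθ : ‖θ‖ = 1) :
    ∃ K : ENNReal, K ≠ ⊤ ∧
      (volume.restrict (Metric.ball (0 : Space d) 1)).map (fun q => inner ℝ θ q) ≤
        K • intervalMeasure := by
  have hd : 0 < d := by
    rcases Nat.eq_zero_or_pos d with rfl | h
    · have : θ = 0 := Subsingleton.elim _ _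
      simp [this] at hθ
    · exact h
  let i₀ : Fin d := ⟨0, hd⟩
  have hon : Orthonormal ℝ (({i₀} : Set (Fin d)).domRestrict fun _ => θ) :=
    ⟨fun _ => hθ, fun i j hij => absurd (Subsingleton.elim i j) hij⟩
  obtain ⟨b, hb⟩ := hon.exists_orthonormalBasis_extension_of_card_eq (by simp)
  have hb0 : b i₀ = θ := hb i₀ rfl
  have hmp := (EuclideanSpace.volume_preserving_symm_measurableEquiv_toLp (Fin d)).comp
    b.measurePreserving_repr
  refine ⟨∏ i ∈ Finset.univ.erase i₀, volume (Set.Icc (-1 : ℝ) 1),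
    (ENNReal.prod_lt_top fun _ _ => by simp).ne, ?_⟩
  refine Measure.le_iff.mpr fun A hA => ?_
  rw [Measure.map_apply (by fun_prop) hA, Measure.restrict_apply (hA.preimage (by fun_prop))]
  let t : Fin d → Set ℝ := fun i => if i = i₀ then A ∩ Set.Icc (-1) 1 else Set.Icc (-1) 1
  have ht : ∀ i, MeasurableSet (t i) := by
    intro i
    by_cases h : i = i₀
    · simp [t, h, hA.inter measurableSet_Icc]
    · simp [t, h]
  have hsub : (fun q => inner ℝ θ q) ⁻¹' A ∩ Metric.ball (0 : Space d) 1 ⊆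
      (⇑(MeasurableEquiv.toLp 2 (Fin d → ℝ)).symm ∘ ⇑b.repr) ⁻¹' (Set.univ.pi t) := by
    rintro q ⟨hq, hq1⟩ i -
    have h1 : inner ℝ (b i) q ∈ Set.Icc (-1 : ℝ) 1 := by
      rw [Set.mem_Icc, ← abs_le]
      refine (abs_real_inner_le_norm _ _).trans ?_
      rw [b.norm_eq_one, one_mul]
      exact (mem_ball_zero_iff.mp hq1).le
    have h2 : ((⇑(MeasurableEquiv.toLp 2 (Fin d → ℝ)).symm ∘ ⇑b.repr) q) i = inner ℝ (b i) q :=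
      b.repr_apply_apply q i
    rw [h2]
    by_cases h : i = i₀
    · simp only [t, h, if_true]
      rw [h] at h1
      exact ⟨by rw [hb0]; exact hq, h1⟩
    · simp only [t, h, if_false]
      exact h1
  refine (measure_mono hsub).trans ?_
  rw [hmp.measure_preimage (MeasurableSet.univ_pi ht).nullMeasurableSet, volume_pi_pi,
    ← Finset.mul_prod_erase _ _ (Finset.mem_univ i₀), Measure.smul_apply, smul_eq_mul, mul_comm]
  have h1 : t i₀ = A ∩ Set.Icc (-1) 1 := by simp [t]
  rw [h1, intervalMeasure, Measure.restrict_apply hA]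
  gcongr with i hi
  simp [t, Finset.ne_of_mem_erase hi]

/-- A square-integrable function `v` supported in the unit ball has, along every direction `θ`, a
Radon transform in `L²([-1, 1])`, characterised here by its Fourier transform (the projection-slice
identity). It is the Riesz representative of the functional `φ ↦ ∫ φ (θ · q) v q dq`. -/
theorem exists_slice {d : ℕ} {θ : Space d} (hθ : ‖θ‖ = 1) {v : Space d → ℂ}
    (hv : MemLp v 2 volume) (hsupp : ∀ᵐ q, q ∉ Metric.ball (0 : Space d) 1 → v q = 0) :
    ∃ f : ℝ → ℂ, MemLp f 2 intervalMeasure ∧ ∀ s : ℝ,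
      ∫ y in Set.Icc (-1 : ℝ) 1, Complex.exp (Complex.I * ((s * y : ℝ) : ℂ)) * f y =
        ∫ q : Space d, Complex.exp (Complex.I * ((s * inner ℝ θ q : ℝ) : ℂ)) * v q := by
  obtain ⟨K, hK, hle⟩ := map_inner_restrict_ball_le hθ
  set ν := volume.restrict (Metric.ball (0 : Space d) 1) with hν
  have hmeas : Measurable fun q : Space d => inner ℝ θ q := by fun_prop
  have hac : ν.map (fun q => inner ℝ θ q) ≪ intervalMeasure :=
    (Measure.absolutelyContinuous_of_le hle).trans Measure.smul_absolutelyContinuous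
  have hqmp : Measure.QuasiMeasurePreserving (fun q : Space d => inner ℝ θ q) ν intervalMeasure :=
    ⟨hmeas, hac⟩
  have hmap : ∀ φ : ℝ → ℂ, MemLp φ 2 intervalMeasure →
      MemLp φ 2 (ν.map fun q => inner ℝ θ q) := fun φ hφ =>
    (hφ.smul_measure hK).mono_measure hle
  have hcomp : ∀ φ : ℝ → ℂ, MemLp φ 2 intervalMeasure →
      MemLp (fun q : Space d => φ (inner ℝ θ q)) 2 ν := fun φ hφ =>
    (memLp_map_measure_iff (hmap φ hφ).1 hmeas.aemeasurable).mp (hmap φ hφ)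
  have hnorm : ∀ φ : ℝ → ℂ, MemLp φ 2 intervalMeasure →
      eLpNorm (fun q : Space d => φ (inner ℝ θ q)) 2 ν ≤
        K ^ (1 / (2 : ENNReal)).toReal * eLpNorm φ 2 intervalMeasure := by
    intro φ hφ
    have h1 : eLpNorm (fun q : Space d => φ (inner ℝ θ q)) 2 ν =
        eLpNorm φ 2 (ν.map fun q => inner ℝ θ q) :=
      (eLpNorm_map_measure (hmap φ hφ).1 hmeas.aemeasurable).symm
    rw [h1]
    refine (eLpNorm_mono_measure φ hle).trans ?_
    rw [eLpNorm_smul_measure_of_ne_top (by norm_num), smul_eq_mul]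
  let P : Lp ℂ 2 intervalMeasure →ₗ[ℂ] Lp ℂ 2 ν :=
    { toFun := fun φ => (hcomp φ (Lp.memLp φ)).toLp
      map_add' := fun φ χ => by
        refine Lp.ext ?_
        filter_upwards [(hcomp _ (Lp.memLp (φ + χ))).coeFn_toLp,
          (hcomp _ (Lp.memLp φ)).coeFn_toLp, (hcomp _ (Lp.memLp χ)).coeFn_toLp,
          Lp.coeFn_add (hcomp _ (Lp.memLp φ)).toLp (hcomp _ (Lp.memLp χ)).toLp,
          hqmp.ae (Lp.coeFn_add φ χ)] with q e1 e2 e3 e4 e5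
        rw [e1, e4, Pi.add_apply, e2, e3, e5, Pi.add_apply]
      map_smul' := fun a φ => by
        refine Lp.ext ?_
        filter_upwards [(hcomp _ (Lp.memLp (a • φ))).coeFn_toLp,
          (hcomp _ (Lp.memLp φ)).coeFn_toLp,
          Lp.coeFn_smul a (hcomp _ (Lp.memLp φ)).toLp,
          hqmp.ae (Lp.coeFn_smul a φ)] with q e1 e2 e4 e5
        rw [RingHom.id_apply, e1, e4, Pi.smul_apply, e2, e5, Pi.smul_apply] }
  have hP : ∀ φ, ‖P φ‖ ≤ (K ^ (1 / (2 : ENNReal)).toReal).toReal * ‖φ‖ := by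
    intro φ
    have hKt : K ^ (1 / (2 : ENNReal)).toReal ≠ ⊤ := ENNReal.rpow_ne_top_of_nonneg (by simp) hK
    have h1 : ‖P φ‖ = (eLpNorm (fun q : Space d => φ (inner ℝ θ q)) 2 ν).toReal :=
      Lp.norm_toLp _ (hcomp φ (Lp.memLp φ))
    rw [h1, Lp.norm_def, ← ENNReal.toReal_mul]
    exact ENNReal.toReal_mono (ENNReal.mul_ne_top hKt (Lp.eLpNorm_ne_top φ))
      (hnorm φ (Lp.memLp φ))
  have hvν : MemLp v 2 ν := hv.restrict _
  -- the inner product is conjugate-linear on the left, hence the conjugates of `v` and of `g`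
  let L : Lp ℂ 2 intervalMeasure →L[ℂ] ℂ :=
    (innerSL ℂ (hvν.star.toLp : Lp ℂ 2 ν)).comp (P.mkContinuous _ hP)
  let g : Lp ℂ 2 intervalMeasure := (InnerProductSpace.toDual ℂ _).symm L
  have hg : ∀ φ, inner ℂ g φ = L φ := fun φ => InnerProductSpace.toDual_symm_apply
  refine ⟨star g, (Lp.memLp g).star, fun s => ?_⟩
  have he : MemLp (fun y : ℝ => Complex.exp (Complex.I * ((s * y : ℝ) : ℂ))) 2 intervalMeasure :=
    memLp_of_continuous (by fun_prop)
  have h1 := hg he.toLp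
  have h2 : inner ℂ g he.toLp = ∫ y in Set.Icc (-1 : ℝ) 1,
      Complex.exp (Complex.I * ((s * y : ℝ) : ℂ)) * (star g : ℝ → ℂ) y := by
    rw [L2.inner_def]
    refine integral_congr_ae ?_
    filter_upwards [he.coeFn_toLp] with y e1
    rw [e1, RCLike.inner_apply]
    rfl
  have h3 : L he.toLp = ∫ q,
      Complex.exp (Complex.I * ((s * inner ℝ θ q : ℝ) : ℂ)) * v q ∂ν := by
    have : L he.toLp = inner ℂ hvν.star.toLp (P he.toLp) := rfl
    rw [this, L2.inner_def]
    refine integral_congr_ae ?_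
    filter_upwards [hvν.star.coeFn_toLp, (hcomp _ (Lp.memLp he.toLp)).coeFn_toLp,
      hqmp.ae he.coeFn_toLp] with q e1 e2 e3
    have e4 : P he.toLp q = Complex.exp (Complex.I * ((s * inner ℝ θ q : ℝ) : ℂ)) := e2.trans e3
    rw [e1, e4, RCLike.inner_apply, Pi.star_apply]
    simp
  rw [← h2, h1, h3, hν]
  refine setIntegral_eq_integral_of_ae_compl_eq_zero ?_
  filter_upwards [hsupp] with q hq hq1
  rw [hq hq1, mul_zero]

/-! ### Fourier inversion in `L²` with a spherical cut-off -/

section Plancherel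

open scoped FourierTransform SchwartzMap ContDiff

variable {E : Type*} [NormedAddCommGroup E] [InnerProductSpace ℝ E] [FiniteDimensional ℝ E]
  [MeasurableSpace E] [BorelSpace E]

/-- Locally integrable functions with the same integrals against Schwartz functions agree almost
everywhere. -/
theorem ae_eq_of_integral_schwartz_smul_eq {f g : E → ℂ} (hf : LocallyIntegrable f volume)
    (hg : LocallyIntegrable g volume)
    (h : ∀ φ : 𝓢(E, ℂ), ∫ x, φ x • f x = ∫ x, φ x • g x) : f =ᵐ[volume] g := by
  refine ae_eq_of_integral_contDiff_smul_eq hf hg fun φ hφ hc => ?_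
  have hc' : HasCompactSupport (Complex.ofRealCLM ∘ φ) := hc.comp_left rfl
  have hφ' : ContDiff ℝ ∞ (Complex.ofRealCLM ∘ φ) := by fun_prop
  simpa using h (hc'.toSchwartzMap hφ')

/-- On `L¹ ∩ L²` the Fourier transform on `L²` is given by the Fourier integral. -/
theorem coeFn_fourier_toLp {f : E → ℂ} (hf : Integrable f volume) (hf2 : MemLp f 2 volume) :
    (𝓕 (hf2.toLp f) : Lp ℂ 2 (volume : Measure E)) =ᵐ[volume] 𝓕 f := by
  have hcont : Continuous (𝓕 f) := VectorFourier.fourierIntegral_continuous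
    Real.continuous_fourierChar (by exact continuous_inner) hf
  refine ae_eq_of_integral_schwartz_smul_eq ((Lp.memLp _).locallyIntegrable (by norm_num))
    hcont.locallyIntegrable fun φ => ?_
  have h1 : ∫ x, φ x • 𝓕 f x = ∫ x, 𝓕 φ x • f x := by
    simpa using! (VectorFourier.integral_fourierIntegral_smul_eq_flip (L := innerₗ E)
      Real.continuous_fourierChar continuous_inner φ.integrable hf).symm
  have h2 := congrArg (fun T => T φ) (Lp.fourier_toTemperedDistribution_eq (hf2.toLp f))
  simp only [TemperedDistribution.fourier_apply, Lp.toTemperedDistribution_apply] at h2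
  rw [h1, ← h2]
  refine integral_congr_ae ?_
  filter_upwards [hf2.coeFn_toLp] with x hx
  rw [hx]

/-- On `L¹ ∩ L²` the inverse Fourier transform on `L²` is given by the inverse Fourier
integral. -/
theorem coeFn_fourierInv_toLp {f : E → ℂ} (hf : Integrable f volume) (hf2 : MemLp f 2 volume) :
    (𝓕⁻ (hf2.toLp f) : Lp ℂ 2 (volume : Measure E)) =ᵐ[volume] 𝓕⁻ f := by
  have hcont : Continuous (𝓕⁻ f) := VectorFourier.fourierIntegral_continuous
    Real.continuous_fourierChar (by exact continuous_inner.neg) hf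
  refine ae_eq_of_integral_schwartz_smul_eq ((Lp.memLp _).locallyIntegrable (by norm_num))
    hcont.locallyIntegrable fun φ => ?_
  have h1 : ∫ x, φ x • 𝓕⁻ f x = ∫ x, 𝓕⁻ φ x • f x := by
    have h := (VectorFourier.integral_fourierIntegral_smul_eq_flip (L := -innerₗ E)
      Real.continuous_fourierChar continuous_inner.neg (φ.integrable (μ := volume)) hf).symm
    have hflip : (-innerₗ E).flip = -innerₗ E := by
      ext x y
      simp [real_inner_comm]
    rw [hflip] at h
    rw [SchwartzMap.fourierInv_coe]
    exact h
  have h2 := congrArg (fun T => T φ) (Lp.fourierInv_toTemperedDistribution_eq (hf2.toLp f))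
  simp only [TemperedDistribution.fourierInv_apply, Lp.toTemperedDistribution_apply] at h2
  rw [h1, ← h2]
  refine integral_congr_ae ?_
  filter_upwards [hf2.coeFn_toLp] with x hx
  rw [hx]

/-- Cutting off a square-integrable function to balls of growing radius converges to it in
`L²`. -/
theorem tendsto_eLpNorm_indicator_closedBall_sub {g : E → ℂ} (hg : MemLp g 2 volume) :
    Tendsto (fun R : ℝ => eLpNorm ((Metric.closedBall (0 : E) R).indicator g - g) 2 volume)
      atTop (𝓝 0) := by
  have h1 : Tendsto (fun R : ℝ =>
      ∫⁻ x, ‖((Metric.closedBall (0 : E) R).indicator g - g) x‖ₑ ^ (2 : ℝ))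
      atTop (𝓝 (∫⁻ _ : E, 0)) := by
    refine tendsto_lintegral_filter_of_dominated_convergence' (fun x => ‖g x‖ₑ ^ (2 : ℝ))
      ?_ ?_ ?_ ?_
    · exact Eventually.of_forall fun R =>
        (((hg.1.indicator Metric.isClosed_closedBall.measurableSet).sub hg.1).enorm).pow_const _
    · refine Eventually.of_forall fun R => Eventually.of_forall fun x => ?_
      gcongr
      by_cases hx : x ∈ Metric.closedBall (0 : E) R <;> simp [hx]
    · have := lintegral_rpow_enorm_lt_top_of_eLpNorm_lt_top (by norm_num) (by norm_num) hg.2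
      simpa using this.ne
    · refine Eventually.of_forall fun x => tendsto_const_nhds.congr' ?_
      filter_upwards [eventually_ge_atTop ‖x‖] with R hR
      simp [hR]
  rw [lintegral_zero] at h1
  have h2 := h1.ennrpow_const (1 / 2)
  simp only [eLpNorm_eq_lintegral_rpow_enorm_toReal (p := 2) (by norm_num) (by norm_num),
    ENNReal.toReal_ofNat]
  simpa using h2

theorem integrable_indicator_closedBall {g : E → ℂ} (hg : Continuous g) (R : ℝ) :
    Integrable ((Metric.closedBall (0 : E) R).indicator g) volume :=
  (integrable_indicator_iff Metric.isClosed_closedBall.measurableSet).mpr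
    (hg.continuousOn.integrableOn_compact (isCompact_closedBall 0 R))

/-- Fourier inversion: for `v ∈ L¹ ∩ L²` the Fourier integrals of the inverse Fourier transform of
`v` over balls of growing radius converge to `v` in `L²`. -/
theorem tendsto_fourier_indicator_fourierInv {v : E → ℂ} (hv : Integrable v volume)
    (hv2 : MemLp v 2 volume) :
    (∀ R : ℝ, MemLp (𝓕 ((Metric.closedBall (0 : E) R).indicator (𝓕⁻ v))) 2 volume) ∧
      Tendsto (fun R : ℝ =>
        eLpNorm (𝓕 ((Metric.closedBall (0 : E) R).indicator (𝓕⁻ v)) - v) 2 volume)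
        atTop (𝓝 0) := by
  have hcont : Continuous (𝓕⁻ v) := VectorFourier.fourierIntegral_continuous
    Real.continuous_fourierChar (by exact continuous_inner.neg) hv
  have hG := coeFn_fourierInv_toLp hv hv2
  have hG2 : MemLp (𝓕⁻ v) 2 volume := (Lp.memLp _).ae_eq hG
  have hGLp : hG2.toLp = 𝓕⁻ (hv2.toLp v) := Lp.ext (hG2.coeFn_toLp.trans hG.symm)
  have hI2 : ∀ R : ℝ, MemLp ((Metric.closedBall (0 : E) R).indicator (𝓕⁻ v)) 2 volume := fun R =>
    hG2.indicator Metric.isClosed_closedBall.measurableSet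
  have hF := fun R : ℝ => coeFn_fourier_toLp (integrable_indicator_closedBall hcont R) (hI2 R)
  refine ⟨fun R => (Lp.memLp _).ae_eq (hF R), ?_⟩
  refine (tendsto_eLpNorm_indicator_closedBall_sub hG2).congr fun R => ?_
  have h1 : eLpNorm (𝓕 ((Metric.closedBall (0 : E) R).indicator (𝓕⁻ v)) - v) 2 volume
      = ‖(𝓕 ((hI2 R).toLp _) : Lp ℂ 2 (volume : Measure E)) - hv2.toLp v‖ₑ := by
    rw [Lp.enorm_def]
    refine eLpNorm_congr_ae ?_
    filter_upwards [hF R, hv2.coeFn_toLp,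
      Lp.coeFn_sub (𝓕 ((hI2 R).toLp _) : Lp ℂ 2 (volume : Measure E)) (hv2.toLp v)] with x e1 e2 e3
    rw [e3, Pi.sub_apply, Pi.sub_apply, e1, e2]
  have h2 : eLpNorm ((Metric.closedBall (0 : E) R).indicator (𝓕⁻ v) - 𝓕⁻ v) 2 volume
      = ‖(hI2 R).toLp _ - hG2.toLp‖ₑ := by
    rw [← MemLp.toLp_sub, Lp.enorm_toLp]
  have h3 : (𝓕 ((hI2 R).toLp _) : Lp ℂ 2 (volume : Measure E)) - hv2.toLp v
      = Lp.fourierTransformₗᵢ E ℂ ((hI2 R).toLp _ - hG2.toLp) := by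
    rw [map_sub, hGLp]
    congr 1
    exact ((Lp.fourierTransformₗᵢ E ℂ).apply_symm_apply _).symm
  rw [h1, h2, h3, LinearIsometryEquiv.enorm_map]

end Plancherel

/-! ### Polar coordinates -/

/-- Integration in polar coordinates over a ball centred at the origin. -/
theorem integral_sphere_Ioc {d : ℕ} (hd : 1 ≤ d) {F : Space d → ℂ} (hF : Continuous F) (R : ℝ) :
    ∫ θ : Sphere d, (∫ s in Set.Ioc (0 : ℝ) R,
      F (s • (θ : Space d)) * ((s ^ (d - 1) : ℝ) : ℂ)) ∂(volume : Measure (Space d)).toSphere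
      = ∫ p, (Metric.closedBall (0 : Space d) R).indicator F p := by
  have : Nonempty (Fin d) := ⟨⟨0, hd⟩⟩
  set G : Space d → ℂ := (Metric.closedBall (0 : Space d) R).indicator F with hG
  have hGi : Integrable G volume := integrable_indicator_closedBall hF R
  have hmp := (volume : Measure (Space d)).measurePreserving_homeomorphUnitSphereProd
  have hemb := (homeomorphUnitSphereProd (Space d)).measurableEmbedding
  have hdim : Module.finrank ℝ (Space d) = d := by simp
  rw [hdim] at hmp
  let H : Sphere d × Set.Ioi (0 : ℝ) → ℂ := fun x => G (x.2.1 • (x.1 : Space d))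
  have hHcomp : ∀ x : ({0}ᶜ : Set (Space d)), H (homeomorphUnitSphereProd (Space d) x) = G x := by
    intro x
    have hx : ‖(x : Space d)‖ ≠ 0 := norm_ne_zero_iff.mpr x.2
    simp [H, smul_smul, hx]
  have h1 : ∫ p, G p = ∫ x, H x
      ∂((volume : Measure (Space d)).toSphere.prod (Measure.volumeIoiPow (d - 1))) := by
    rw [← hmp.integral_comp hemb]
    simp_rw [hHcomp]
    rw [integral_subtype_comap (measurableSet_singleton _).compl, restrict_compl_singleton]
  have hHi : Integrable H
      ((volume : Measure (Space d)).toSphere.prod (Measure.volumeIoiPow (d - 1))) := by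
    rw [← hmp.integrable_comp_emb hemb]
    have : H ∘ homeomorphUnitSphereProd (Space d) = G ∘ Subtype.val := funext hHcomp
    rw [this, ← integrableOn_iff_comap_subtypeVal (measurableSet_singleton _).compl]
    exact hGi.integrableOn
  rw [h1, integral_prod _ hHi]
  refine integral_congr_ae (Eventually.of_forall fun θ => ?_)
  simp only [Measure.volumeIoiPow, ENNReal.ofReal, H]
  rw [integral_withDensity_eq_integral_smul
      ((measurable_subtype_coe.pow_const _).real_toNNReal),
    integral_subtype_comap measurableSet_Ioi
      fun s : ℝ => Real.toNNReal (s ^ (d - 1)) • G (s • (θ : Space d))]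
  have h2 : ∀ s ∈ Set.Ioi (0 : ℝ), Real.toNNReal (s ^ (d - 1)) • G (s • (θ : Space d)) =
      (Set.Ioc (0 : ℝ) R).indicator
        (fun s => F (s • (θ : Space d)) * ((s ^ (d - 1) : ℝ) : ℂ)) s := by
    intro s hs
    have hs0 : 0 < s := hs
    have hnorm : ‖s • (θ : Space d)‖ = s := by
      rw [norm_smul, Real.norm_of_nonneg hs0.le, norm_eq_of_mem_sphere, mul_one]
    rw [NNReal.smul_def, Real.coe_toNNReal _ (pow_nonneg hs0.le _), Complex.real_smul, mul_comm]
    by_cases hsR : s ≤ R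
    · rw [Set.indicator_of_mem (show s ∈ Set.Ioc 0 R from ⟨hs0, hsR⟩), hG,
        Set.indicator_of_mem (by rwa [mem_closedBall_zero_iff, hnorm])]
    · rw [Set.indicator_of_notMem (fun h => hsR h.2), hG,
        Set.indicator_of_notMem (by rwa [mem_closedBall_zero_iff, hnorm]), zero_mul]
  rw [setIntegral_congr_fun measurableSet_Ioi h2, setIntegral_indicator measurableSet_Ioc,
    Set.inter_eq_right.mpr fun s hs => hs.1]

/-! ### Reconstruction from band-limited data -/

section Dilation

variable {d : ℕ} {σ : ℝ}

theorem quasiMeasurePreserving_smul_space (hσ : σ ≠ 0) :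
    Measure.QuasiMeasurePreserving (fun q : Space d => σ • q) volume volume := by
  refine ⟨by fun_prop, ?_⟩
  rw [Measure.map_addHaar_smul volume hσ]
  exact Measure.smul_absolutelyContinuous

theorem memLp_comp_smul (hσ : σ ≠ 0) {v : Space d → ℂ} (hv : MemLp v 2 volume) :
    MemLp (fun q => v (σ • q)) 2 volume := by
  have hm : MemLp v 2 ((volume : Measure (Space d)).map fun q => σ • q) := by
    rw [Measure.map_addHaar_smul volume hσ]
    exact hv.smul_measure ENNReal.ofReal_ne_top
  exact (memLp_map_measure_iff hm.1 (by fun_prop)).mp hm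

theorem ae_comp_smul_eq_zero (hσ : 0 < σ) {v : Space d → ℂ}
    (hsupp : ∀ᵐ q, q ∉ Metric.ball (0 : Space d) σ → v q = 0) :
    ∀ᵐ q, q ∉ Metric.ball (0 : Space d) 1 → v (σ • q) = 0 := by
  filter_upwards [(quasiMeasurePreserving_smul_space hσ.ne').ae hsupp] with q hq hq1
  refine hq fun h => hq1 ?_
  rw [mem_ball_zero_iff, norm_smul, Real.norm_of_nonneg hσ.le] at h
  rw [mem_ball_zero_iff]
  exact (mul_lt_iff_lt_one_right hσ).mp h

theorem integrable_of_ae_eq_zero {v : Space d → ℂ} (hv : MemLp v 2 volume)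
    (hsupp : ∀ᵐ q, q ∉ Metric.ball (0 : Space d) σ → v q = 0) : Integrable v volume := by
  have : IsFiniteMeasure (volume.restrict (Metric.ball (0 : Space d) σ)) :=
    isFiniteMeasure_restrict.mpr measure_ball_lt_top.ne
  have h1 : IntegrableOn v (Metric.ball (0 : Space d) σ) volume :=
    (hv.restrict (Metric.ball (0 : Space d) σ)).integrable (by norm_num)
  exact h1.integrable_of_ae_notMem_eq_zero hsupp

/-- The data along the direction `θ` are the band-limited Fourier transform of the slice of the
rescaled function. -/
theorem lineData_ae_eq_bandOp {r : ℝ} (hr : 0 < r) (hσ : 0 < σ) {v V : Space d → ℂ}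
    (hV : Set.EqOn V (fourierHat v) (Metric.ball (0 : Space d) r)) (θ : Sphere d) {f : ℝ → ℂ}
    (hf : ∀ s : ℝ, ∫ y in Set.Icc (-1 : ℝ) 1, Complex.exp (Complex.I * ((s * y : ℝ) : ℂ)) * f y =
      ∫ q : Space d, Complex.exp (Complex.I * ((s * inner ℝ (θ : Space d) q : ℝ) : ℂ)) *
        v (σ • q)) :
    lineData r σ V θ =ᵐ[intervalMeasure] bandOp (r * σ) f := by
  have hIoo : ∀ᵐ x ∂intervalMeasure, x ∈ Set.Ioo (-1 : ℝ) 1 := by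
    rw [intervalMeasure, ← restrict_Ioo_eq_restrict_Icc]
    exact ae_restrict_mem measurableSet_Ioo
  filter_upwards [hIoo] with x hx
  have hmem : (r * x) • (θ : Space d) ∈ Metric.ball (0 : Space d) r := by
    rw [mem_ball_zero_iff, norm_smul, norm_eq_of_mem_sphere, mul_one, Real.norm_eq_abs, abs_mul,
      abs_of_pos hr]
    exact mul_lt_of_lt_one_right hr (abs_lt.mpr hx)
  rw [lineData, hV hmem, fourierHat, bandOp, hf (r * σ * x)]
  have h1 := Measure.integral_comp_smul (volume : Measure (Space d))
    (fun q => Complex.exp (Complex.I * ((inner ℝ ((r * x) • (θ : Space d)) q : ℝ) : ℂ)) * v q) σ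
  have h2 : ∫ q : Space d, Complex.exp (Complex.I *
      ((r * σ * x * inner ℝ (θ : Space d) q : ℝ) : ℂ)) * v (σ • q) =
      ∫ q : Space d, Complex.exp (Complex.I *
        ((inner ℝ ((r * x) • (θ : Space d)) (σ • q) : ℝ) : ℂ)) * v (σ • q) := by
    congr 1
    ext q
    rw [inner_smul_left, inner_smul_right, conj_trivial]
    congr 4
    ring
  rw [h2, h1, finrank_euclideanSpace_fin, abs_of_pos (by positivity), Complex.real_smul]
  have hπ : ((2 * Real.pi : ℝ) : ℂ) ≠ 0 := Complex.ofReal_ne_zero.mpr (by positivity)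
  have hσ' : (σ : ℂ) ≠ 0 := Complex.ofReal_ne_zero.mpr hσ.ne'
  rw [← mul_assoc]
  congr 1
  rw [div_pow, Complex.ofReal_div, Complex.ofReal_pow, Complex.ofReal_inv, Complex.ofReal_pow]
  field_simp

end Dilation

section Radon

open scoped FourierTransform

variable {d : ℕ}

theorem integral_exp_inner_mul_eq_fourierInv (v : Space d → ℂ) (p : Space d) :
    ∫ q, Complex.exp (Complex.I * ((inner ℝ p q : ℝ) : ℂ)) * v q =
      𝓕⁻ v ((2 * Real.pi)⁻¹ • p) := by
  rw [Real.fourierInv_eq']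
  congr 1
  ext q
  have hπ : (Real.pi : ℂ) ≠ 0 := Complex.ofReal_ne_zero.mpr Real.pi_ne_zero
  rw [inner_smul_right, real_inner_comm, smul_eq_mul]
  congr 2
  push_cast
  field_simp

/-- In polar coordinates, the truncated inverse Radon transform of the slices of `v` is the Fourier
integral of the inverse Fourier transform of `v` over a ball. -/
theorem radonInvTrunc_eq_fourier (hd : 1 ≤ d) {v : Space d → ℂ} (hv : Integrable v volume)
    {u : ℝ → Sphere d → ℂ}
    (hu : ∀ (s : ℝ) (θ : Sphere d), ∫ t : ℝ, Complex.exp (Complex.I * ((s * t : ℝ) : ℂ)) * u t θ =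
      ∫ q, Complex.exp (Complex.I * ((s * inner ℝ (θ : Space d) q : ℝ) : ℂ)) * v q) (R : ℝ) :
    radonInvTrunc u R =
      𝓕 ((Metric.closedBall (0 : Space d) (R / (2 * Real.pi))).indicator (𝓕⁻ v)) := by
  ext q
  have hπ : (0 : ℝ) < 2 * Real.pi := by positivity
  have hπ' : ((2 * Real.pi : ℝ) : ℂ) ≠ 0 := Complex.ofReal_ne_zero.mpr hπ.ne'
  have hcont : Continuous (𝓕⁻ v) := VectorFourier.fourierIntegral_continuous
    Real.continuous_fourierChar (by exact continuous_inner.neg) hv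
  let F : Space d → ℂ := fun p => Complex.exp (-Complex.I * ((inner ℝ p q : ℝ) : ℂ)) *
    (1 / ((2 * Real.pi : ℝ) : ℂ) * 𝓕⁻ v ((2 * Real.pi)⁻¹ • p))
  have hF : Continuous F := by
    have := hcont.comp (continuous_const_smul (2 * Real.pi)⁻¹ : Continuous fun p : Space d => _)
    exact (by fun_prop : Continuous fun p : Space d =>
      Complex.exp (-Complex.I * ((inner ℝ p q : ℝ) : ℂ))).mul (continuous_const.mul this)
  have hline : ∀ (s : ℝ) (θ : Sphere d),
      Complex.exp (-Complex.I * ((s * inner ℝ (θ : Space d) q : ℝ) : ℂ)) * lineHat u s θ =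
        F (s • (θ : Space d)) := by
    intro s θ
    simp only [F]
    rw [lineHat, hu, ← integral_exp_inner_mul_eq_fourierInv]
    simp only [real_inner_smul_left]
  rw [radonInvTrunc]
  simp only [hline]
  rw [integral_sphere_Ioc hd hF]
  have h1 := Measure.integral_comp_smul (volume : Measure (Space d))
    ((Metric.closedBall (0 : Space d) R).indicator F) (2 * Real.pi)
  rw [finrank_euclideanSpace_fin, abs_of_pos (by positivity), Complex.real_smul] at h1
  have h2 : ∫ p, (Metric.closedBall (0 : Space d) R).indicator F p = ((2 * Real.pi : ℝ) : ℂ) ^ d *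
      ∫ x : Space d, (Metric.closedBall (0 : Space d) R).indicator F ((2 * Real.pi) • x) := by
    rw [h1, Complex.ofReal_inv, Complex.ofReal_pow, mul_inv_cancel_left₀ (pow_ne_zero d hπ')]
  rw [h2, Real.fourier_eq', ← mul_assoc, ← integral_const_mul]
  congr 1
  ext x
  have hmem : (2 * Real.pi) • x ∈ Metric.closedBall (0 : Space d) R ↔
      x ∈ Metric.closedBall (0 : Space d) (R / (2 * Real.pi)) := by
    rw [mem_closedBall_zero_iff, mem_closedBall_zero_iff, norm_smul, Real.norm_of_nonneg hπ.le,
      le_div_iff₀ hπ, mul_comm]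
  by_cases hx : x ∈ Metric.closedBall (0 : Space d) (R / (2 * Real.pi))
  · rw [Set.indicator_of_mem (hmem.mpr hx), Set.indicator_of_mem hx]
    simp only [F]
    have e1 : Complex.exp (-Complex.I * ((inner ℝ ((2 * Real.pi) • x) q : ℝ) : ℂ)) =
        Complex.exp (((-2 * Real.pi * inner ℝ x q : ℝ) : ℂ) * Complex.I) := by
      rw [real_inner_smul_left]
      congr 1
      push_cast
      ring
    rw [smul_smul, inv_mul_cancel₀ hπ.ne', one_smul, e1, smul_eq_mul]
    obtain ⟨k, rfl⟩ := Nat.exists_eq_add_of_le hd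
    rw [Nat.add_sub_cancel_left, pow_add, pow_one]
    field_simp
  · rw [Set.indicator_of_notMem (fun h => hx (hmem.mp h)), Set.indicator_of_notMem hx, mul_zero,
      smul_zero]

/-- Any `u` with the Fourier transforms of the slices of `v` has inverse Radon transform `v`; no
joint measurability of `u` is needed, since only its one-dimensional Fourier transforms enter. -/
theorem isRadonInverse_of_slices (hd : 1 ≤ d) {v : Space d → ℂ} (hv : Integrable v volume)
    (hv2 : MemLp v 2 volume) {u : ℝ → Sphere d → ℂ}
    (hu : ∀ (s : ℝ) (θ : Sphere d), ∫ t : ℝ, Complex.exp (Complex.I * ((s * t : ℝ) : ℂ)) * u t θ =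
      ∫ q, Complex.exp (Complex.I * ((s * inner ℝ (θ : Space d) q : ℝ) : ℂ)) * v q) :
    IsRadonInverse u v := by
  obtain ⟨h1, h2⟩ := tendsto_fourier_indicator_fourierInv hv hv2
  refine ⟨hv2, fun R => ?_, ?_⟩
  · rw [radonInvTrunc_eq_fourier hd hv hu]
    exact h1 _
  · simp only [radonInvTrunc_eq_fourier hd hv hu]
    exact h2.comp (tendsto_id.atTop_div_const (by positivity))

end Radon

section Reconstruction

variable {d : ℕ} {r σ : ℝ} {v V : Space d → ℂ} {ψ : ℕ → ℝ → ℝ} {μ : ℕ → ℂ}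

/-- The slices of the rescaled function invert the data along all directions. -/
theorem exists_isBandInverse_slices (hr : 0 < r) (hσ : 0 < σ) (hv : MemLp v 2 volume)
    (hsupp : ∀ᵐ q, q ∉ Metric.ball (0 : Space d) σ → v q = 0) (hψ : IsPSWF (r * σ) ψ μ)
    (hV : Set.EqOn V (fourierHat v) (Metric.ball (0 : Space d) r)) :
    ∃ f : Sphere d → ℝ → ℂ, (∀ θ, IsBandInverse ψ μ (lineData r σ V θ) (f θ)) ∧
      ∀ (θ : Sphere d) (s : ℝ),
        ∫ y in Set.Icc (-1 : ℝ) 1, Complex.exp (Complex.I * ((s * y : ℝ) : ℂ)) * f θ y =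
          ∫ q : Space d, Complex.exp (Complex.I * ((s * inner ℝ (θ : Space d) q : ℝ) : ℂ)) *
            v (σ • q) := by
  choose f hf hslice using fun θ : Sphere d => exists_slice (norm_eq_of_mem_sphere θ)
    (memLp_comp_smul hσ.ne' hv) (ae_comp_smul_eq_zero hσ hsupp)
  exact ⟨f, fun θ => hψ.isBandInverse (mul_pos hr hσ).ne' (hf θ)
    (lineData_ae_eq_bandOp hr hσ hV θ (hslice θ)), hslice⟩

theorem isRadonInverse_extendByZero (hd : 1 ≤ d) (hr : 0 < r) (hσ : 0 < σ) (hv : MemLp v 2 volume)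
    (hsupp : ∀ᵐ q, q ∉ Metric.ball (0 : Space d) σ → v q = 0) (hψ : IsPSWF (r * σ) ψ μ)
    (hV : Set.EqOn V (fourierHat v) (Metric.ball (0 : Space d) r)) {h : Sphere d → ℝ → ℂ}
    (hh : ∀ θ, IsBandInverse ψ μ (lineData r σ V θ) (h θ)) :
    IsRadonInverse (extendByZero h) fun q => v (σ • q) := by
  obtain ⟨f, hf, hslice⟩ := exists_isBandInverse_slices hr hσ hv hsupp hψ hV
  have hv' := memLp_comp_smul hσ.ne' hv
  refine isRadonInverse_of_slices hd
    (integrable_of_ae_eq_zero hv' (ae_comp_smul_eq_zero hσ hsupp)) hv' fun s θ => ?_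
  rw [← hslice θ s, ← integral_indicator measurableSet_Icc]
  have h1 : ∫ t : ℝ, Complex.exp (Complex.I * ((s * t : ℝ) : ℂ)) * extendByZero h t θ =
      ∫ y in Set.Icc (-1 : ℝ) 1, Complex.exp (Complex.I * ((s * y : ℝ) : ℂ)) * h θ y := by
    rw [← integral_indicator measurableSet_Icc]
    congr 1
    ext t
    by_cases ht : t ∈ Set.Icc (-1 : ℝ) 1 <;> simp [extendByZero, ht]
  rw [h1, integral_indicator measurableSet_Icc]
  refine integral_congr_ae ?_
  filter_upwards [(hh θ).ae_eq hψ.memLp (hf θ)] with y hy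
  rw [hy]

end Reconstruction

end PSWF

theorem theorem1p1 (d : ℕ) (hd : 1 ≤ d) (r σ : ℝ) (hr : 0 < r) (hσ : 0 < σ)
    (v : PSWF.Space d → ℂ) (hv : MemLp v 2 volume)
    (hsupp : ∀ᵐ q, q ∉ Metric.ball (0 : PSWF.Space d) σ → v q = 0) :
    -- the prolate spheroidal wave functions of bandwidth `c = rσ` exist
    (∃ (ψ : ℕ → ℝ → ℝ) (μ : ℕ → ℂ), PSWF.IsPSWF (r * σ) ψ μ) ∧
    -- reconstruction from any `V` that agrees with the Fourier transform of `v` on `B_r`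
    (∀ (ψ : ℕ → ℝ → ℝ) (μ : ℕ → ℂ), PSWF.IsPSWF (r * σ) ψ μ →
      (∀ j, μ j ≠ 0) ∧
      ∀ V : PSWF.Space d → ℂ,
        Set.EqOn V (PSWF.fourierHat v) (Metric.ball (0 : PSWF.Space d) r) →
        (∃ h : PSWF.Sphere d → ℝ → ℂ,
          ∀ θ, PSWF.IsBandInverse ψ μ (PSWF.lineData r σ V θ) (h θ)) ∧
        ∀ h : PSWF.Sphere d → ℝ → ℂ,
          (∀ θ, PSWF.IsBandInverse ψ μ (PSWF.lineData r σ V θ) (h θ)) →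
          ∃ w : PSWF.Space d → ℂ, PSWF.IsRadonInverse (PSWF.extendByZero h) w ∧
            ∀ᵐ q, v q = w (σ⁻¹ • q)) ∧
    -- hence the Fourier transform on `B_r` determines `v`
    (∀ v' : PSWF.Space d → ℂ, MemLp v' 2 volume →
      (∀ᵐ q, q ∉ Metric.ball (0 : PSWF.Space d) σ → v' q = 0) →
      Set.EqOn (PSWF.fourierHat v') (PSWF.fourierHat v) (Metric.ball (0 : PSWF.Space d) r) →
      v' =ᵐ[volume] v) := by
  have hc : r * σ ≠ 0 := (mul_pos hr hσ).ne'
  refine ⟨PSWF.exists_isPSWF hc, fun ψ μ hψ => ⟨hψ.eigenvalue_ne_zero hc, fun V hV => ⟨?_, ?_⟩⟩,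
    fun v' hv' hsupp' heq => ?_⟩
  · obtain ⟨f, hf, -⟩ := PSWF.exists_isBandInverse_slices hr hσ hv hsupp hψ hV
    exact ⟨f, hf⟩
  · intro h hh
    refine ⟨_, PSWF.isRadonInverse_extendByZero hd hr hσ hv hsupp hψ hV hh,
      Eventually.of_forall fun q => ?_⟩
    rw [smul_smul, mul_inv_cancel₀ hσ.ne', one_smul]
  · -- both functions are reconstructed from the same data
    obtain ⟨ψ, μ, hψ⟩ := PSWF.exists_isPSWF hc
    obtain ⟨f, hf, -⟩ := PSWF.exists_isBandInverse_slices hr hσ hv hsupp hψ (fun _ _ => rfl)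
    have h1 := PSWF.isRadonInverse_extendByZero hd hr hσ hv hsupp hψ (fun _ _ => rfl) hf
    have h2 := PSWF.isRadonInverse_extendByZero hd hr hσ hv' hsupp' hψ heq.symm hf
    filter_upwards [(PSWF.quasiMeasurePreserving_smul_space (inv_ne_zero hσ.ne')).ae
      (h2.ae_eq h1)] with q hq
    simpa only [smul_smul, mul_inv_cancel₀ hσ.ne', one_smul] using hq
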